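/- Setting. Consider a periodic event-triggered control (PETC) system with checking period $1$: plant $\dot\xi=A\xi+B\upsilon$ with $\xi(t)\in\mathbb R^n$, sampled feedback $\upsilon(t)=K\xi(t_i)$ for $t\in[t_i,t_{i+1})$, symmetric triggering matrix $Q\in\mathbb R^{2n\times 2n}$ and maximum inter-sample time $\bar k\ge 1$. Put $\mathcal Y=\{1,\dots,\bar k\}$ and $$M(k)=e^{Ak}+\int_0^k e^{A\tau}d\tau\,BK,\qquad N(k)=\begin{bmatrix}M(k)\\ I\end{bmatrix}^{\top}Q\begin{bmatrix}M(k)\\ I\end{bmatrix},\qquad \kappa(x)=\min\{k\in\mathcal Y: x^\top N(k)x>0\text{ or }k=\bar k\}.$$ The traffic model $\mathcal S$ is the transition system with state set and initial set $\mathbb R^n$, transitions $x\to M(\kappa(x))x$ and output map $\kappa$. Its infinite (external) behaviors are the output sequences of its runs, and $\mathcal B^l(\mathcal S)\subseteq\mathcal Y^l$ is the set of length-$l$ prefixes of these behaviors. Let $\mathcal K_k=\{x:x^\top N(k)x>0\}$ for $k<\bar k$, $\mathcal K_{\bar k}=\mathbb R^n$, and $\mathcal Q_k=\mathcal K_k\setminus\bigcup_{1\le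 j<k}\mathcal K_j$. For a word $\sigma=k_1\cdots k_m$ over $\mathcal Y$ put $M_\sigma=M(k_m)\cdots M(k_1)$, $T_i=M(k_{i-1})\cdots M(k_1)$, and $\mathcal Q_\sigma=\{x: T_ix\in\mathcal Q_{k_i},\ 1\le i\le m\}$. For $\epsilon>0$, the $\epsilon$-inflation of $\mathcal Q_\sigma$ is the set of all $x$ such that, for every $i$, $x^\top(T_i^\top N(k_i)T_i+\epsilon I)x>0$ if $k_i<\bar k$, and $x^\top(-T_i^\top N(j)T_i+\epsilon I)x\ge0$ for all $1\le j<k_i$. For $l\ge1$, the $l$-complete traffic model $\mathcal S_l$ has as states (all of them initial) the words $w\in\mathcal Y^l$ with $\mathcal Q_w\ne\emptyset$, transitions $k\rho\to\rho k'$ (with $k,k'\in\mathcal Y$, $\rho\in\mathcal Y^{l-1}$) between states, and as output of a state its first letter. Each transition of a system with outputs in $\mathcal Y$ gets as weight the output of the state it leaves. The value of a run is the limit inferior of the averages of its first weights. A smallest-in-average cycle (SAC) of $\mathcal S_l$ is a cycle $x_0\to x_1\to\cdots\to x_r\to x_0$ such that the value of the run repeating it forever is the infimum of the values of all runs of $\mathcal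 S_l$; it is identified with its output word. A system $\mathcal S_b$ is a smallest-average-cycle-equivalent (SACE) simulation of $\mathcal S_a$ if both are non-blocking, there is a simulation relation from $\mathcal S_a$ to $\mathcal S_b$, and $\mathcal S_a$ has a behavior $dc^\omega$ with $d$ a finite word and $c$ a SAC of $\mathcal S_b$. The normalized distance between sets is $d_{\mathrm n}(\mathcal A,\mathcal A')=\inf\{1-\frac{a^\top a'}{|a||a'|}: a\in\mathcal A\setminus\{0\},\ a'\in\mathcal A'\setminus\{0\}\}$ ($+\infty$ if there are no such pairs), and $d_{\mathrm n}(x,\mathcal A')=d_{\mathrm n}(\{x\},\mathcal A')$ for $x\neq0$. A word $\sigma$ is regular if (i) $M_\sigma$ is nonsingular, it is mixed (its complex eigenvalues are pairwise distinct, and two different ones have equal modulus only if they are complex conjugates of each other) and it is of irrational rotations (the arguments of its nonreal eigenvalues are irrational multiples of $\pi$), and (ii) for every basic invariant linear subspace $\mathcal A$ of $M_\sigma$ (the span of a real eigenvector, or the real plane spanned by a pair of complex conjugate eigenvectors) there is $\epsilon>0$ with $d_{\mathrm n}(\mathcal A,\partial\mathcal Q_\sigma)\ge\epsilon$. A $\delta$-perturbation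 of $\mathcal S$ is the traffic model $\tilde{\mathcal S}$ of a PETC system with data $\tilde A,\tilde B,\tilde K,\tilde Q,\bar k$ of the same dimensions such that $\|A-\tilde A\|\le\delta$, $\|BK-\tilde B\tilde K\|\le\delta$, $\|Q-\tilde Q\|\le\delta$ in the 2-induced norm. Theorem. Let $l\ge1$ and let $\mathcal S_l$ be a SACE simulation of $\mathcal S$. Let $\sigma$ be a SAC of $\mathcal S_l$ such that $d\sigma^\omega$ is a behavior of $\mathcal S$ for some finite word $d$, and suppose that $\sigma$ is regular. Suppose also that for some $\epsilon>0$: - for every $w\in\mathcal B^l(\mathcal S)$ there is a nonzero $x\in\mathcal Q_w$ with $d_{\mathrm n}(x,\partial\mathcal Q_w)>\epsilon$; - for every $w\in\mathcal Y^l\setminus\mathcal B^l(\mathcal S)$ the $\epsilon$-inflation of $\mathcal Q_w$ is empty. Then there exists $\delta>0$ such that $\mathcal S_l$ is a SACE simulation of every $\delta$-perturbation $\tilde{\mathcal S}$ of $\mathcal S$. -/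

import Mathlib

open Matrix Filter Topology

noncomputable section

/-! ## Transition systems, simulations, quantitative notions -/

/-- A transition system with state set `X` and output set `Y`. -/
structure TransitionSystem (X Y : Type*) where
  init : Set X
  edge : X → X → Prop
  out : X → Y

namespace TransitionSystem

variable {X Xa Xb Y : Type*}

def NonBlocking (S : TransitionSystem X Y) : Prop :=
  ∀ x, ∃ x', S.edge x x'

/-- `r` is a run (infinite internal behavior). -/
def IsRun (S : TransitionSystem X Y) (r : ℕ → X) : Prop :=
  r 0 ∈ S.init ∧ ∀ i, S.edge (r i) (r (i + 1))

/-- The set of traces (infinite external behaviors). -/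
def behaviors (S : TransitionSystem X Y) : Set (ℕ → Y) :=
  {y | ∃ r, S.IsRun r ∧ ∀ i, S.out (r i) = y i}

/-- The set of prefixes of length `l` of the traces. -/
def finBehaviors (S : TransitionSystem X Y) (l : ℕ) : Set (List Y) :=
  {w | ∃ y ∈ S.behaviors, w = List.ofFn (fun i : Fin l => y i)}

/-- `R` is a simulation relation from `Sa` to `Sb`. -/
def IsSimulationRel (Sa : TransitionSystem Xa Y) (Sb : TransitionSystem Xb Y)
    (R : Xa → Xb → Prop) : Prop :=
  (∀ xa ∈ Sa.init, ∃ xb ∈ Sb.init, R xa xb) ∧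
  (∀ xa xb, R xa xb → Sa.out xa = Sb.out xb) ∧
  (∀ xa xb, R xa xb → ∀ xa', Sa.edge xa xa' → ∃ xb', Sb.edge xb xb' ∧ R xa' xb')

/-- `Sb` simulates `Sa`. -/
def Simulates (Sa : TransitionSystem Xa Y) (Sb : TransitionSystem Xb Y) : Prop :=
  ∃ R, IsSimulationRel Sa Sb R

end TransitionSystem

/-- The limit average of a sequence of weights (with values in the extended reals, so that the
limit inferior never takes a default value). -/
def limAvg (v : ℕ → ℚ) : EReal :=
  liminf (fun n : ℕ => (((∑ i ∈ Finset.range (n + 1), (v i : ℝ)) / ((n : ℝ) + 1) : ℝ) : EReal)) atTop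

/-- The infinite repetition of a nonempty finite word. -/
def omegaWord {α : Type*} (w : List α) (hw : w ≠ []) (i : ℕ) : α :=
  w[i % w.length]'(Nat.mod_lt i (List.length_pos_iff.mpr hw))

/-- The infinite word `d y` for a finite word `d` and an infinite word `y`. -/
def prependWord {α : Type*} (d : List α) (y : ℕ → α) (i : ℕ) : α :=
  if h : i < d.length then d[i] else y (i - d.length)

namespace TransitionSystem

variable {X Xa Xb Y : Type*}

/-- The smallest limit average over all runs of the simple weighted transition system in which a
transition has as weight the output of the state it leaves; `wt` reads outputs as rationals. -/
def smallestLimAvg (wt : Y → ℚ) (S : TransitionSystem X Y) : EReal :=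
  ⨅ (r : ℕ → X) (_ : S.IsRun r), limAvg (fun i => wt (S.out (r i)))

/-- The smallest-in-average cycles, each recorded as the word of its outputs: words
`H(x₀) ... H(xₖ)` where `x₀ → x₁ → ... → xₖ → x₀` and the limit average of `(x₀ ... xₖ)^ω` is the
smallest limit average of the system. -/
def smallestAvgCycles (wt : Y → ℚ) (S : TransitionSystem X Y) : Set (List Y) :=
  {c | ∃ (xs : List X) (h : xs ≠ []),
    (∀ i, S.edge (omegaWord xs h i) (omegaWord xs h (i + 1))) ∧
    limAvg (fun i => wt (S.out (omegaWord xs h i))) = S.smallestLimAvg wt ∧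
    c = xs.map S.out}

/-- After a finite transient, the nonempty word `c` is repeated forever in some behavior of `S`,
that is, `d c^ω` is a behavior of `S` for some finite word `d`. -/
def EventuallyRepeats (S : TransitionSystem X Y) (c : List Y) : Prop :=
  ∃ (hc : c ≠ []) (d : List Y), prependWord d (omegaWord c hc) ∈ S.behaviors

/-- `Sb` is a smallest-average-cycle-equivalent (SACE) simulation of `Sa`. -/
def IsSACESimulation (wt : Y → ℚ) (Sa : TransitionSystem Xa Y) (Sb : TransitionSystem Xb Y) :
    Prop :=
  Sa.NonBlocking ∧ Sb.NonBlocking ∧ Simulates Sa Sb ∧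
    ∃ c ∈ Sb.smallestAvgCycles wt, Sa.EventuallyRepeats c

end TransitionSystem

/-! ## Linear algebra and cones -/

/-- `xᵀ P x`. -/
def quadVal {n : ℕ} (P : Matrix (Fin n) (Fin n) ℝ) (x : Fin n → ℝ) : ℝ := x ⬝ᵥ (P *ᵥ x)

/-- The open quadratic cone `xᵀ P x > 0`. -/
def openCone {n : ℕ} (P : Matrix (Fin n) (Fin n) ℝ) : Set (Fin n → ℝ) := {x | 0 < quadVal P x}

/-- The closed quadratic cone `xᵀ P x ≥ 0`. -/
def closedCone {n : ℕ} (P : Matrix (Fin n) (Fin n) ℝ) : Set (Fin n → ℝ) := {x | 0 ≤ quadVal P x}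

/-- The Euclidean norm of a vector. -/
def euclNorm {n : ℕ} (x : Fin n → ℝ) : ℝ := ‖(WithLp.toLp 2 x : EuclideanSpace ℝ (Fin n))‖

/-- The 2-induced norm of a square matrix. -/
def opNorm2 {ι : Type*} [Fintype ι] [DecidableEq ι] (M : Matrix ι ι ℝ) : ℝ :=
  ‖Matrix.toEuclideanCLM (𝕜 := ℝ) M‖

/-- The normalized distance between a nonzero point and a set: the infimum is over the nonzero
elements of the set, as the cosine makes sense only for these. It is `⊤` if there are none. -/
def normDist {n : ℕ} (x : Fin n → ℝ) (A : Set (Fin n → ℝ)) : EReal :=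
  ⨅ (a : Fin n → ℝ) (_ : a ∈ A) (_ : a ≠ 0),
    ((1 - (a ⬝ᵥ x) / (euclNorm a * euclNorm x) : ℝ) : EReal)

/-- The normalized distance between two sets. -/
def normDistSets {n : ℕ} (A A' : Set (Fin n → ℝ)) : EReal :=
  ⨅ (a : Fin n → ℝ) (_ : a ∈ A) (_ : a ≠ 0), normDist a A'

/-- The complex eigenvalues of a real matrix, with algebraic multiplicity. -/
def complexEigenvalues {n : ℕ} (M : Matrix (Fin n) (Fin n) ℝ) : Multiset ℂ :=
  (M.map (algebraMap ℝ ℂ)).charpoly.roots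

/-- A mixed matrix: no eigenvalue is repeated, and two different eigenvalues have the same modulus
only if they are complex conjugates of each other. -/
def IsMixed {n : ℕ} (M : Matrix (Fin n) (Fin n) ℝ) : Prop :=
  (complexEigenvalues M).Nodup ∧
  ∀ z ∈ complexEigenvalues M, ∀ w ∈ complexEigenvalues M,
    z ≠ w → ‖z‖ = ‖w‖ → z = (starRingEnd ℂ) w

/-- A matrix of irrational rotations: the arguments of all its nonreal eigenvalues are irrational
multiples of `π`. -/
def IsOfIrrationalRotations {n : ℕ} (M : Matrix (Fin n) (Fin n) ℝ) : Prop :=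
  ∀ z ∈ complexEigenvalues M, z.im ≠ 0 → Irrational (z.arg / Real.pi)

/-- A basic invariant linear subspace: the line spanned by a real eigenvector, or the real span of
a pair of complex conjugate eigenvectors `w`, `w*` with nonreal eigenvalues, which is the span of
the real and imaginary parts of `w`. -/
def IsBasicInvariant {n : ℕ} (M : Matrix (Fin n) (Fin n) ℝ) (V : Submodule ℝ (Fin n → ℝ)) : Prop :=
  (∃ (μ : ℝ) (v : Fin n → ℝ), v ≠ 0 ∧ M *ᵥ v = μ • v ∧ V = Submodule.span ℝ {v}) ∨
  (∃ (μ : ℂ) (w : Fin n → ℂ), μ.im ≠ 0 ∧ w ≠ 0 ∧ (M.map (algebraMap ℝ ℂ)) *ᵥ w = μ • w ∧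
    V = Submodule.span ℝ {(fun i => (w i).re), (fun i => (w i).im)})

/-! ## Periodic event-triggered control -/

/-- The set `{1, ..., kbar}` of inter-sample times. -/
abbrev IST (kbar : ℕ) : Type := Set.Icc 1 kbar

/-- An inter-sample time as a rational weight. -/
def istWeight {kbar : ℕ} (k : IST kbar) : ℚ := ((k : ℕ) : ℚ)

/-- The data of a PETC system with state dimension `n`, input dimension `p`, checking period `1`
and maximum inter-sample time `kbar`: the plant `ξ' = A ξ + B u`, the feedback `u = K ξ(tᵢ)`, and
the symmetric triggering matrix `Q`. -/
structure PETC (n p kbar : ℕ) where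
  A : Matrix (Fin n) (Fin n) ℝ
  B : Matrix (Fin n) (Fin p) ℝ
  K : Matrix (Fin p) (Fin n) ℝ
  Q : Matrix (Fin n ⊕ Fin n) (Fin n ⊕ Fin n) ℝ
  Q_symm : Q.IsSymm
  one_le_kbar : 1 ≤ kbar

namespace PETC

variable {n p kbar : ℕ}

/-- `M(k) = e^{A k} + (∫₀ᵏ e^{A τ} dτ) B K`, with the integral taken entrywise. -/
def M (P : PETC n p kbar) (k : ℕ) : Matrix (Fin n) (Fin n) ℝ :=
  NormedSpace.exp ((k : ℝ) • P.A) +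
    (Matrix.of fun i j => ∫ τ in (0 : ℝ)..(k : ℝ), (NormedSpace.exp (τ • P.A)) i j) * (P.B * P.K)

/-- `N(k) = [M(k); I]ᵀ Q [M(k); I]`. -/
def N (P : PETC n p kbar) (k : ℕ) : Matrix (Fin n) (Fin n) ℝ :=
  (Matrix.fromRows (P.M k) 1 : Matrix (Fin n ⊕ Fin n) (Fin n) ℝ)ᵀ * P.Q *
    (Matrix.fromRows (P.M k) 1 : Matrix (Fin n ⊕ Fin n) (Fin n) ℝ)

/-- The inter-sample times at which the triggering condition holds at state `x`. -/
def triggerSet (P : PETC n p kbar) (x : Fin n → ℝ) : Set ℕ :=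
  {k | (1 ≤ k ∧ k ≤ kbar) ∧ (0 < quadVal (P.N k) x ∨ k = kbar)}

theorem triggerSet_nonempty (P : PETC n p kbar) (x : Fin n → ℝ) : (P.triggerSet x).Nonempty :=
  ⟨kbar, ⟨P.one_le_kbar, le_refl _⟩, Or.inr rfl⟩

/-- The next inter-sample time from state `x`. -/
def kappa (P : PETC n p kbar) (x : Fin n → ℝ) : IST kbar :=
  ⟨sInf (P.triggerSet x), (Nat.sInf_mem (P.triggerSet_nonempty x)).1⟩

/-- The traffic model `S`. -/
def traffic (P : PETC n p kbar) : TransitionSystem (Fin n → ℝ) (IST kbar) where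
  init := Set.univ
  edge x x' := x' = P.M (P.kappa x) *ᵥ x
  out := P.kappa

/-- The set `K_k`. -/
def coneK (P : PETC n p kbar) (k : ℕ) : Set (Fin n → ℝ) :=
  if k < kbar then openCone (P.N k) else Set.univ

/-- The set `Q_k` of the states from which the next trigger happens after exactly `k` time units. -/
def coneQ (P : PETC n p kbar) (k : ℕ) : Set (Fin n → ℝ) :=
  P.coneK k ∩ ⋂ j ∈ Finset.Ico 1 k, (P.coneK j)ᶜ

/-- `M_σ = M(k_m) ⋯ M(k_1)` for `σ = k_1 ... k_m`. -/
def Mword (P : PETC n p kbar) : List (IST kbar) → Matrix (Fin n) (Fin n) ℝ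
  | [] => 1
  | k :: σ => Mword P σ * P.M k

/-- The `σ`-cone `Q_σ`: `M(k_{i-1}) ⋯ M(k_1) x ∈ Q_{k_i}` for all `i`. -/
def coneWord (P : PETC n p kbar) (σ : List (IST kbar)) : Set (Fin n → ℝ) :=
  {x | ∀ (i : ℕ) (h : i < σ.length), P.Mword (σ.take i) *ᵥ x ∈ P.coneQ (σ[i] : ℕ)}

/-- The `ε`-inflation of `Q_σ`. With `T = M(k_{i-1}) ⋯ M(k_1)`, the set `Q_σ` is the intersection
over `i` of the cones `xᵀ (Tᵀ N(k_i) T) x > 0` (if `k_i < kbar`) and `xᵀ (-(Tᵀ N(j) T)) x ≥ 0` for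
`1 ≤ j < k_i`; in the inflation `ε I` is added to each of the matrices. -/
def inflatedConeWord (P : PETC n p kbar) (ε : ℝ) (σ : List (IST kbar)) : Set (Fin n → ℝ) :=
  {x | ∀ (i : ℕ) (h : i < σ.length),
    ((σ[i] : ℕ) < kbar →
      x ∈ openCone ((P.Mword (σ.take i))ᵀ * P.N (σ[i] : ℕ) * P.Mword (σ.take i) + ε • 1)) ∧
    ∀ j : ℕ, 1 ≤ j → j < (σ[i] : ℕ) →
      x ∈ closedCone (-((P.Mword (σ.take i))ᵀ * P.N j * P.Mword (σ.take i)) + ε • 1)}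

/-- The inter-sample sequence relation `R_l`. -/
def relR (P : PETC n p kbar) (l : ℕ) (x : Fin n → ℝ) (w : List (IST kbar)) : Prop :=
  w.length = l ∧ x ∈ P.coneWord w

/-- The state set of the `l`-complete model, the projection of the state space along `R_l`. -/
def LState (P : PETC n p kbar) (l : ℕ) : Type :=
  {w : List (IST kbar) // ∃ x, P.relR l x w}

/-- The `l`-complete PETC traffic model `S_l`, `l ≥ 1`. -/
def lComplete (P : PETC n p kbar) (l : ℕ) (hl : 1 ≤ l) :
    TransitionSystem (P.LState l) (IST kbar) where
  init := Set.univ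
  edge w w' := ∃ (k k' : IST kbar) (σ : List (IST kbar)), w.1 = k :: σ ∧ w'.1 = σ ++ [k']
  out w := w.1[0]'(by obtain ⟨_, h, _⟩ := w.2; omega)

/-- A regular sequence of inter-sample times. -/
def IsRegular (P : PETC n p kbar) (σ : List (IST kbar)) : Prop :=
  (IsUnit (P.Mword σ).det ∧ IsMixed (P.Mword σ) ∧ IsOfIrrationalRotations (P.Mword σ)) ∧
  ∀ V : Submodule ℝ (Fin n → ℝ), IsBasicInvariant (P.Mword σ) V →
    ∃ ε : ℝ, 0 < ε ∧ (ε : EReal) ≤ normDistSets (V : Set (Fin n → ℝ)) (frontier (P.coneWord σ))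

/-- The nondegeneracy premises on the `l`-complete model: for some `ε > 0`, the cone of every word
that occurs contains a nonzero point at normalized distance more than `ε` from its boundary, and the
`ε`-inflation of the cone of every word of length `l` that does not occur is empty. -/
def NondegeneratePremises (P : PETC n p kbar) (l : ℕ) : Prop :=
  ∃ ε : ℝ, 0 < ε ∧
    (∀ σ : List (IST kbar), σ ∈ P.traffic.finBehaviors l →
      ∃ x ∈ P.coneWord σ, x ≠ 0 ∧ (ε : EReal) < normDist x (frontier (P.coneWord σ))) ∧
    (∀ σ : List (IST kbar), σ.length = l → σ ∉ P.traffic.finBehaviors l →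
      P.inflatedConeWord ε σ = ∅)

/-- `P'` is a `δ`-perturbation of `P`. -/
def IsPerturbation (P P' : PETC n p kbar) (δ : ℝ) : Prop :=
  opNorm2 (P.A - P'.A) ≤ δ ∧ opNorm2 (P.B * P.K - P'.B * P'.K) ≤ δ ∧ opNorm2 (P.Q - P'.Q) ≤ δ

end PETC

end

/-! The model $\mathcal S_l$ is not perturbed, so it stays non-blocking and $\sigma$ stays a SAC of
it. Traffic models never block. Two things must survive a small change of $A$, $BK$, $Q$: the
simulation by $\mathcal S_l$, and the behavior $\sigma^\omega$. Both are shown for all systems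
eventually along the filter `nearData`, which is turned into a $\delta$ at the end.

Simulation holds as soon as the perturbed system has no new words of length $l$. Its forms differ
from the original ones by at most $\epsilon|x|^2$, so its cone of a word lies in the
$\epsilon$-inflation of the old cone, which is empty if the word did not occur. There are finitely
many words (`eventually_simulates_lComplete`).

For $\sigma^\omega$, take $x\ne0$ whose orbit under $M_\sigma$ stays in $\mathcal Q_\sigma$. After
rescaling it accumulates at some $d\ne0$ carried by the eigenvalues of largest modulus in $x$;
mixedness makes these one real eigenvalue or a conjugate pair, so $d$ lies in a basic invariant line
or plane (`exists_dominant_basicInvariant`). Regularity keeps that subspace off $\partial\mathcal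
Q_\sigma$, so $d$ is interior, and in the plane case connectedness extends this to all nonzero
vectors. Interior points satisfy every inequality strictly (`mem_strictConeWord_of_eventually`): a
tight one would make its form negative semidefinite, and then a word that cannot occur would have a
nonempty inflation. Strict inequalities are open in state and system. Simple eigenvalues persist,
and the adjugate gives eigenvectors depending continuously on the data, so the perturbed $M_\sigma$
has an invariant line or plane whose nonzero vectors lie in the perturbed cone. -/

noncomputable section

/-! ## Quadratic forms -/

section Quadratic

variable {n : ℕ}

theorem quadVal_smul (A : Matrix (Fin n) (Fin n) ℝ) (c : ℝ) (x : Fin n → ℝ) :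
    quadVal A (c • x) = c ^ 2 * quadVal A x := by
  simp only [quadVal, mulVec_smul, smul_dotProduct, dotProduct_smul, smul_eq_mul]
  ring

theorem quadVal_zero (A : Matrix (Fin n) (Fin n) ℝ) : quadVal A 0 = 0 := by
  simp [quadVal]

theorem quadVal_add (A B : Matrix (Fin n) (Fin n) ℝ) (x : Fin n → ℝ) :
    quadVal (A + B) x = quadVal A x + quadVal B x := by
  simp [quadVal, add_mulVec]

theorem quadVal_neg (A : Matrix (Fin n) (Fin n) ℝ) (x : Fin n → ℝ) :
    quadVal (-A) x = -quadVal A x := by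
  simp [quadVal, neg_mulVec]

theorem quadVal_smul_one (ε : ℝ) (x : Fin n → ℝ) :
    quadVal (ε • (1 : Matrix (Fin n) (Fin n) ℝ)) x = ε * (x ⬝ᵥ x) := by
  simp [quadVal, smul_mulVec]

theorem quadVal_conj (A T : Matrix (Fin n) (Fin n) ℝ) (x : Fin n → ℝ) :
    quadVal (Tᵀ * A * T) x = quadVal A (T *ᵥ x) := by
  simp only [quadVal, ← mulVec_mulVec]
  rw [dotProduct_mulVec, vecMul_transpose]

theorem quadVal_parallelogram (A : Matrix (Fin n) (Fin n) ℝ) (x y : Fin n → ℝ) :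
    quadVal A (x + y) + quadVal A (x - y) = 2 * quadVal A x + 2 * quadVal A y := by
  simp only [quadVal, mulVec_add, mulVec_sub, add_dotProduct, sub_dotProduct, dotProduct_add,
    dotProduct_sub]
  ring

theorem continuous_quadVal :
    Continuous fun q : Matrix (Fin n) (Fin n) ℝ × (Fin n → ℝ) => quadVal q.1 q.2 := by
  unfold quadVal
  exact continuous_snd.dotProduct (continuous_fst.matrix_mulVec continuous_snd)

/-- A quadratic form with a local maximum of value zero is negative semidefinite. -/
theorem quadVal_nonpos_of_eventually {A : Matrix (Fin n) (Fin n) ℝ} {y : Fin n → ℝ}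
    (hy : quadVal A y = 0) (h : ∀ᶠ z in 𝓝 y, quadVal A z ≤ 0) (z : Fin n → ℝ) :
    quadVal A z ≤ 0 := by
  have h1 : Tendsto (fun t : ℝ => y + t • z) (𝓝 0) (𝓝 y) := by
    have : Continuous fun t : ℝ => y + t • z := by fun_prop
    simpa using this.tendsto 0
  have h2 : Tendsto (fun t : ℝ => y - t • z) (𝓝 0) (𝓝 y) := by
    have : Continuous fun t : ℝ => y - t • z := by fun_prop
    simpa using this.tendsto 0
  have h3 : ∀ᶠ t : ℝ in 𝓝[≠] 0, quadVal A (y + t • z) ≤ 0 ∧ quadVal A (y - t • z) ≤ 0 :=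
    ((h1.eventually h).and (h2.eventually h)).filter_mono nhdsWithin_le_nhds
  obtain ⟨t, ⟨hp, hm⟩, ht⟩ := (h3.and self_mem_nhdsWithin).exists
  -- As the form vanishes at $y$, the values at $y\pm tz$ add up to $2t^2$ times its value at $z$.
  have h4 := quadVal_parallelogram A y (t • z)
  rw [quadVal_smul, hy] at h4
  have ht2 : 0 < t ^ 2 := by
    have : t ≠ 0 := ht
    positivity
  by_contra! hz
  nlinarith [mul_pos ht2 hz]

theorem dotProduct_self_pos_of_ne_zero {x : Fin n → ℝ} (hx : x ≠ 0) : 0 < x ⬝ᵥ x :=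
  lt_of_le_of_ne (by
    simpa [dotProduct] using Finset.sum_nonneg fun i _ => mul_self_nonneg (x i))
    (Ne.symm (by simpa using hx))

end Quadratic

/-! ## Limits of matrix products -/

section Limits

variable {ι 𝕜 α β γ : Type*} [RCLike 𝕜] {l : Filter ι}

theorem tendsto_matrix_mul [Fintype β] {A : ι → Matrix α β 𝕜} {B : ι → Matrix β γ 𝕜}
    {A₀ : Matrix α β 𝕜} {B₀ : Matrix β γ 𝕜} (hA : Tendsto A l (𝓝 A₀)) (hB : Tendsto B l (𝓝 B₀)) :
    Tendsto (fun a => A a * B a) l (𝓝 (A₀ * B₀)) := by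
  have hc : Continuous fun D : Matrix α β 𝕜 × Matrix β γ 𝕜 => D.1 * D.2 :=
    continuous_fst.matrix_mul continuous_snd
  have h1 := hc.tendsto (A₀, B₀)
  have h2 := h1.comp (hA.prodMk_nhds hB)
  exact h2

theorem tendsto_matrix_mulVec [Fintype β] {A : ι → Matrix α β 𝕜} {x : ι → β → 𝕜}
    {A₀ : Matrix α β 𝕜} {x₀ : β → 𝕜} (hA : Tendsto A l (𝓝 A₀)) (hx : Tendsto x l (𝓝 x₀)) :
    Tendsto (fun a => A a *ᵥ x a) l (𝓝 (A₀ *ᵥ x₀)) := by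
  have hc : Continuous fun D : Matrix α β 𝕜 × (β → 𝕜) => D.1 *ᵥ D.2 :=
    continuous_fst.matrix_mulVec continuous_snd
  have h1 := hc.tendsto (A₀, x₀)
  have h2 := h1.comp (hA.prodMk_nhds hx)
  exact h2

theorem tendsto_matrix_transpose {A : ι → Matrix α β 𝕜} {A₀ : Matrix α β 𝕜}
    (hA : Tendsto A l (𝓝 A₀)) : Tendsto (fun a => (A a)ᵀ) l (𝓝 A₀ᵀ) := by
  have hc : Continuous fun D : Matrix α β 𝕜 => Dᵀ := continuous_id.matrix_transpose
  have h1 := hc.tendsto A₀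
  have h2 := h1.comp hA
  exact h2

end Limits

/-! ## Words of inter-sample times -/

namespace PETC

variable {n p kbar : ℕ}

theorem mem_coneK_iff (P : PETC n p kbar) {k : ℕ} (hk : k ≤ kbar) (x : Fin n → ℝ) :
    x ∈ P.coneK k ↔ 0 < quadVal (P.N k) x ∨ k = kbar := by
  unfold coneK
  split_ifs with h
  · simp [openCone, h.ne]
  · simp [le_antisymm hk (not_lt.mp h)]

/-- Every $j<k$ is below $\bar k$, so the complements of the earlier cones are genuine quadratic
inequalities; only the condition at $k$ itself disappears when $k=\bar k$. -/
theorem mem_coneQ_iff (P : PETC n p kbar) (k : IST kbar) (x : Fin n → ℝ) :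
    x ∈ P.coneQ k ↔ ((k : ℕ) < kbar → 0 < quadVal (P.N k) x) ∧
      ∀ j : ℕ, 1 ≤ j → j < k → quadVal (P.N j) x ≤ 0 := by
  have hk := k.2.2
  simp only [coneQ, Set.mem_inter_iff, Set.mem_iInter, Finset.mem_Ico, Set.mem_compl_iff,
    mem_coneK_iff P hk]
  refine and_congr ?_ ?_
  · constructor
    · rintro (h | h) h'
      · exact h
      · omega
    · intro h
      rcases hk.lt_or_eq with h' | h'
      · exact Or.inl (h h')
      · exact Or.inr h'
  · constructor
    · intro h j h1 h2
      have := h j ⟨h1, h2⟩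
      rw [mem_coneK_iff P (by omega)] at this
      push Not at this
      exact this.1
    · rintro h j ⟨h1, h2⟩
      rw [mem_coneK_iff P (by omega)]
      push Not
      exact ⟨h j h1 h2, by omega⟩

theorem kappa_eq_iff (P : PETC n p kbar) (k : IST kbar) (x : Fin n → ℝ) :
    P.kappa x = k ↔ x ∈ P.coneQ k := by
  rw [mem_coneQ_iff]
  have hmem : (P.kappa x : ℕ) ∈ P.triggerSet x := Nat.sInf_mem (P.triggerSet_nonempty x)
  have hmin : ∀ j, j < (P.kappa x : ℕ) → j ∉ P.triggerSet x := fun j hj =>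
    Nat.notMem_of_lt_sInf hj
  have hk := k.2
  constructor
  · rintro rfl
    refine ⟨fun h => ?_, fun j h1 h2 => ?_⟩
    · rcases hmem.2 with h' | h'
      · exact h'
      · omega
    · by_contra! h
      exact hmin j h2 ⟨⟨h1, by have := hmem.1.2; omega⟩, Or.inl h⟩
  · rintro ⟨h1, h2⟩
    apply Subtype.ext
    refine le_antisymm (Nat.sInf_le ⟨hk, ?_⟩) ?_
    · rcases hk.2.lt_or_eq with h' | h'
      · exact Or.inl (h1 h')
      · exact Or.inr h'
    · by_contra! h
      rcases hmem.2 with h' | h'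
      · exact absurd (h2 _ hmem.1.1 h) (not_le.mpr h')
      · have := hk.2
        omega

theorem smul_mem_coneQ (P : PETC n p kbar) {k : IST kbar} {x : Fin n → ℝ} (hx : x ∈ P.coneQ k)
    {c : ℝ} (hc : c ≠ 0) : c • x ∈ P.coneQ k := by
  have hc2 : 0 < c ^ 2 := by positivity
  rw [mem_coneQ_iff] at hx ⊢
  simp only [quadVal_smul]
  exact ⟨fun h => mul_pos hc2 (hx.1 h), fun j h1 h2 =>
    mul_nonpos_of_nonneg_of_nonpos hc2.le (hx.2 j h1 h2)⟩

@[simp]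
theorem mem_coneWord_nil (P : PETC n p kbar) (x : Fin n → ℝ) : x ∈ P.coneWord [] := by
  intro i h
  simp at h

theorem mem_coneWord_cons (P : PETC n p kbar) (k : IST kbar) (σ : List (IST kbar))
    (x : Fin n → ℝ) :
    x ∈ P.coneWord (k :: σ) ↔ x ∈ P.coneQ k ∧ P.M k *ᵥ x ∈ P.coneWord σ := by
  constructor
  · intro h
    refine ⟨?_, fun i hi => ?_⟩
    · have h0 := h 0 (by simp)
      rw [List.take_zero, Mword, one_mulVec] at h0
      exact h0
    · have h1 := h (i + 1) (by simpa using hi)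
      rw [List.take_succ_cons, Mword, ← mulVec_mulVec] at h1
      exact h1
  · rintro ⟨h0, h1⟩ i hi
    rcases i with _ | i
    · simpa [Mword] using h0
    · simpa [Mword, mulVec_mulVec] using h1 i (by simpa using hi)

theorem smul_mem_coneWord (P : PETC n p kbar) {σ : List (IST kbar)} {x : Fin n → ℝ}
    (hx : x ∈ P.coneWord σ) {c : ℝ} (hc : c ≠ 0) : c • x ∈ P.coneWord σ := by
  intro i hi
  rw [mulVec_smul]
  exact P.smul_mem_coneQ (hx i hi) hc

/-- The successor of a state in the traffic model. -/
def step (P : PETC n p kbar) (x : Fin n → ℝ) : Fin n → ℝ := P.M (P.kappa x) *ᵥ x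

/-- The word of the first `m` inter-sample times from `x`. -/
def itinerary (P : PETC n p kbar) (x : Fin n → ℝ) : ℕ → List (IST kbar)
  | 0 => []
  | m + 1 => P.kappa x :: itinerary P (P.step x) m

@[simp]
theorem length_itinerary (P : PETC n p kbar) (x : Fin n → ℝ) (m : ℕ) :
    (P.itinerary x m).length = m := by
  induction m generalizing x with
  | zero => rfl
  | succ m ih => simp [itinerary, ih]

theorem mem_coneWord_iff (P : PETC n p kbar) (σ : List (IST kbar)) (x : Fin n → ℝ) :
    x ∈ P.coneWord σ ↔ P.itinerary x σ.length = σ := by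
  induction σ generalizing x with
  | nil => simp [itinerary]
  | cons k σ ih =>
    rw [mem_coneWord_cons, ih, ← kappa_eq_iff]
    simp only [List.length_cons, itinerary, List.cons.injEq]
    refine and_congr_right fun h => ?_
    rw [step, h]

theorem mem_coneWord_itinerary (P : PETC n p kbar) (x : Fin n → ℝ) (m : ℕ) :
    x ∈ P.coneWord (P.itinerary x m) := by
  rw [mem_coneWord_iff, length_itinerary]

theorem itinerary_eq_ofFn (P : PETC n p kbar) (x : Fin n → ℝ) (m : ℕ) :
    P.itinerary x m = List.ofFn fun i : Fin m => P.kappa (P.step^[i] x) := by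
  induction m generalizing x with
  | zero => simp [itinerary]
  | succ m ih => simp [itinerary, ih, List.ofFn_succ]

theorem itinerary_succ_append (P : PETC n p kbar) (x : Fin n → ℝ) (m : ℕ) :
    P.itinerary x (m + 1) = P.itinerary x m ++ [P.kappa (P.step^[m] x)] := by
  induction m generalizing x with
  | zero => simp [itinerary]
  | succ m ih =>
    rw [itinerary, ih]
    simp [itinerary]

/-- The dynamics is piecewise linear, and on the cone of a word all the pieces used are known. -/
theorem step_iterate_length (P : PETC n p kbar) {σ : List (IST kbar)} {x : Fin n → ℝ}
    (hx : x ∈ P.coneWord σ) : P.step^[σ.length] x = P.Mword σ *ᵥ x := by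
  induction σ generalizing x with
  | nil => simp [Mword]
  | cons k σ ih =>
    rw [mem_coneWord_cons, ← kappa_eq_iff] at hx
    simp only [List.length_cons, Function.iterate_succ, Function.comp_apply, Mword]
    rw [step, hx.1, ih hx.2, mulVec_mulVec]

/-! ### Runs and behaviors of the traffic model -/

theorem isRun_traffic_iff (P : PETC n p kbar) (r : ℕ → Fin n → ℝ) :
    P.traffic.IsRun r ↔ ∀ i, r i = P.step^[i] (r 0) := by
  constructor
  · rintro ⟨-, h⟩ i
    induction i with
    | zero => rfl
    | succ i ih =>
      rw [Function.iterate_succ_apply', ← ih]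
      exact h i
  · intro h
    refine ⟨Set.mem_univ _, fun i => ?_⟩
    change r (i + 1) = P.step (r i)
    rw [h (i + 1), Function.iterate_succ_apply', ← h i]

theorem mem_behaviors_iff (P : PETC n p kbar) (y : ℕ → IST kbar) :
    y ∈ P.traffic.behaviors ↔ ∃ x, ∀ i, P.kappa (P.step^[i] x) = y i := by
  constructor
  · rintro ⟨r, hr, h⟩
    rw [isRun_traffic_iff] at hr
    exact ⟨r 0, fun i => by rw [← hr i]; exact h i⟩
  · rintro ⟨x, h⟩
    exact ⟨fun i => P.step^[i] x, (isRun_traffic_iff P _).mpr fun i => rfl, h⟩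

theorem mem_finBehaviors_iff (P : PETC n p kbar) (l : ℕ) (w : List (IST kbar)) :
    w ∈ P.traffic.finBehaviors l ↔ ∃ x, P.relR l x w := by
  constructor
  · rintro ⟨y, hy, rfl⟩
    obtain ⟨x, hx⟩ := (mem_behaviors_iff P y).mp hy
    refine ⟨x, by simp, ?_⟩
    rw [mem_coneWord_iff, itinerary_eq_ofFn]
    simp [hx]
  · rintro ⟨x, rfl, hx⟩
    refine ⟨fun i => P.kappa (P.step^[i] x), (mem_behaviors_iff P _).mpr ⟨x, fun _ => rfl⟩, ?_⟩
    rw [← itinerary_eq_ofFn, (mem_coneWord_iff P w x).mp hx]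

theorem nonBlocking_traffic (P : PETC n p kbar) : P.traffic.NonBlocking :=
  fun _ => ⟨_, rfl⟩

theorem mem_coneWord_iff_forall_kappa (P : PETC n p kbar) (σ : List (IST kbar)) (x : Fin n → ℝ) :
    x ∈ P.coneWord σ ↔ ∀ (i : ℕ) (h : i < σ.length), P.kappa (P.step^[i] x) = σ[i] := by
  rw [mem_coneWord_iff, itinerary_eq_ofFn]
  constructor
  · intro h i hi
    simp only [List.ext_get_iff] at h
    simpa using h.2 i (by simpa using hi) hi
  · intro h
    apply List.ext_getElem (by simp)
    intro i _ h2
    simpa using h i h2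

/-- Every state is initial, so the transient can be dropped by starting after it; recurrence of
$\sigma$ then becomes a statement about powers of one matrix. -/
theorem eventuallyRepeats_iff (P : PETC n p kbar) {σ : List (IST kbar)} (hσ : σ ≠ []) :
    P.traffic.EventuallyRepeats σ ↔
      ∃ x, ∀ m : ℕ, (P.Mword σ ^ m) *ᵥ x ∈ P.coneWord σ := by
  have hlen : 0 < σ.length := List.length_pos_iff.mpr hσ
  constructor
  · rintro ⟨_, d, hd⟩
    obtain ⟨x, hx⟩ := (mem_behaviors_iff P _).mp hd
    have hω : ∀ i, P.kappa (P.step^[i] (P.step^[d.length] x)) = omegaWord σ hσ i := by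
      intro i
      rw [← Function.iterate_add_apply, hx]
      simp [prependWord]
    generalize P.step^[d.length] x = y at hω
    refine ⟨y, fun m => ?_⟩
    have hcone : ∀ m : ℕ, P.step^[m * σ.length] y ∈ P.coneWord σ := by
      intro m
      rw [mem_coneWord_iff_forall_kappa]
      intro i hi
      rw [← Function.iterate_add_apply, hω]
      simp [omegaWord, Nat.mod_eq_of_lt hi]
    have hpow : ∀ m : ℕ, P.step^[m * σ.length] y = (P.Mword σ ^ m) *ᵥ y := by
      intro m
      induction m with
      | zero => simp
      | succ m ih =>
        rw [add_mul, one_mul, add_comm, Function.iterate_add_apply,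
          step_iterate_length P (hcone m), ih, mulVec_mulVec, pow_succ']
    rw [← hpow]
    exact hcone m
  · rintro ⟨x, hx⟩
    refine ⟨hσ, [], (mem_behaviors_iff P _).mpr ⟨x, fun i => ?_⟩⟩
    have hpow : ∀ m : ℕ, P.step^[m * σ.length] x = (P.Mword σ ^ m) *ᵥ x := by
      intro m
      induction m with
      | zero => simp
      | succ m ih =>
        rw [add_mul, one_mul, add_comm, Function.iterate_add_apply, ih,
          step_iterate_length P (hx m), mulVec_mulVec, pow_succ']
    have h1 := (mem_coneWord_iff_forall_kappa P σ _).mp (hx (i / σ.length)) (i % σ.length)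
      (Nat.mod_lt _ hlen)
    rw [← hpow, ← Function.iterate_add_apply, mul_comm, Nat.mod_add_div] at h1
    simpa [prependWord, omegaWord] using h1

/-- A traffic model whose words of length `l` all occur in `P` is simulated by the `l`-complete
model of `P`. -/
theorem simulates_lComplete (P P' : PETC n p kbar) (l : ℕ) (hl : 1 ≤ l)
    (h : ∀ w x, P'.relR l x w → ∃ x', P.relR l x' w) :
    TransitionSystem.Simulates P'.traffic (P.lComplete l hl) := by
  have hrel : ∀ x, P'.relR l x (P'.itinerary x l) := fun x =>
    ⟨by simp, mem_coneWord_itinerary P' x l⟩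
  obtain ⟨l, rfl⟩ : ∃ m, l = m + 1 := ⟨l - 1, by omega⟩
  -- A state is related to the word of its own next inter-sample times in `P'`; one step drops the
  -- first letter and appends one. By `h` these words are states of the model of `P`.
  refine ⟨fun x w => w.1 = P'.itinerary x (l + 1), fun x _ => ?_, ?_, ?_⟩
  · exact ⟨⟨P'.itinerary x (l + 1), h _ x (hrel x)⟩, Set.mem_univ _, rfl⟩
  · rintro _ ⟨w, hw⟩ rfl
    rfl
  · rintro x w hw x' rfl
    refine ⟨⟨P'.itinerary (P'.step x) (l + 1), h _ _ (hrel _)⟩, ?_, rfl⟩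
    exact ⟨_, _, P'.itinerary (P'.step x) l, hw, itinerary_succ_append P' _ _⟩

end PETC

/-! ## Small perturbations -/

section Norms

variable {ι : Type*} [Fintype ι] [DecidableEq ι]

theorem abs_entry_le_opNorm2 (A : Matrix ι ι ℝ) (i j : ι) : |A i j| ≤ opNorm2 A := by
  have h1 := (Matrix.toEuclideanCLM (𝕜 := ℝ) A).le_opNorm (WithLp.toLp 2 (Pi.single j 1))
  rw [toEuclideanCLM_toLp, mulVec_single_one] at h1
  have h2 := PiLp.norm_apply_le (WithLp.toLp 2 (A.col j)) i
  have h3 : ‖(WithLp.toLp 2 (Pi.single j 1) : EuclideanSpace ℝ ι)‖ = 1 := by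
    simp
  rw [h3, mul_one] at h1
  exact h2.trans h1

/-- A neighborhood of a matrix contains a ball for the 2-induced norm. -/
theorem exists_opNorm2_ball_subset (A : Matrix ι ι ℝ) {U : Set (Matrix ι ι ℝ)} (hU : U ∈ 𝓝 A) :
    ∃ δ > 0, ∀ A', opNorm2 (A - A') ≤ δ → A' ∈ U := by
  obtain ⟨δ, hδ, h⟩ := (Metric.nhds_basis_closedBall (α := ι → ι → ℝ)).mem_iff.mp hU
  refine ⟨δ, hδ, fun A' hA' => h ?_⟩
  refine (dist_pi_le_iff hδ.le).mpr fun i => (dist_pi_le_iff hδ.le).mpr fun j => ?_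
  rw [dist_comm, Real.dist_eq]
  exact (abs_entry_le_opNorm2 (A - A') i j).trans hA'

theorem continuous_matrix_exp :
    Continuous fun A : Matrix ι ι ℝ => (NormedSpace.exp A : Matrix ι ι ℝ) := by
  -- Any algebra norm will do, provided that it induces the entrywise topology of the statement.
  let : NormedRing (Matrix ι ι ℝ) := Matrix.linftyOpNormedRing
  let : NormedAlgebra ℝ (Matrix ι ι ℝ) := Matrix.linftyOpNormedAlgebra
  let : NormedAlgebra ℚ (Matrix ι ι ℝ) := NormedAlgebra.restrictScalars ℚ ℝ _
  exact NormedSpace.exp_continuous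

end Norms

/-- The bound is a multiple of $x^\top x$ so that it can be compared with the term $\epsilon I$ of
the inflation. -/
theorem abs_quadVal_le {n : ℕ} (D : Matrix (Fin n) (Fin n) ℝ) (x : Fin n → ℝ) :
    |quadVal D x| ≤ (∑ i, ∑ j, |D i j|) * (x ⬝ᵥ x) := by
  have hx : ∀ i j, |x i| * |x j| ≤ x ⬝ᵥ x := by
    intro i j
    have h : ∀ k, |x k| ^ 2 ≤ x ⬝ᵥ x := fun k => by
      rw [sq_abs, sq]
      exact Finset.single_le_sum (f := fun k => x k * x k) (fun k _ => mul_self_nonneg _)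
        (Finset.mem_univ k)
    nlinarith [h i, h j, sq_nonneg (|x i| - |x j|)]
  have h : quadVal D x = ∑ i, ∑ j, x i * (D i j * x j) := by
    simp only [quadVal, dotProduct, mulVec, Finset.mul_sum]
  rw [h]
  simp only [Finset.sum_mul]
  refine (Finset.abs_sum_le_sum_abs _ _).trans (Finset.sum_le_sum fun i _ => ?_)
  refine (Finset.abs_sum_le_sum_abs _ _).trans (Finset.sum_le_sum fun j _ => ?_)
  rw [abs_mul, abs_mul]
  calc |x i| * (|D i j| * |x j|) = |D i j| * (|x i| * |x j|) := by ring
    _ ≤ _ := mul_le_mul_of_nonneg_left (hx i j) (abs_nonneg _)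

/-- Quadratic forms of convergent matrices converge uniformly on the unit sphere. -/
theorem eventually_abs_quadVal_sub_le {n : ℕ} {ι : Type*} {l : Filter ι}
    {A : Matrix (Fin n) (Fin n) ℝ} {S : ι → Matrix (Fin n) (Fin n) ℝ} (hS : Tendsto S l (𝓝 A))
    {ε : ℝ} (hε : 0 < ε) :
    ∀ᶠ a in l, ∀ x, |quadVal (S a) x - quadVal A x| ≤ ε * (x ⬝ᵥ x) := by
  have h : Tendsto (fun a => ∑ i, ∑ j, |(S a - A) i j|) l (𝓝 0) := by
    have h1 : ∀ i j, Tendsto (fun a => |(S a - A) i j|) l (𝓝 0) := fun i j => by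
      have h2 : Continuous fun B : Matrix (Fin n) (Fin n) ℝ => |B i j - A i j| :=
        ((continuous_id.matrix_elem i j).sub continuous_const).abs
      have h3 := h2.tendsto A
      rw [sub_self, abs_zero] at h3
      have h4 := h3.comp hS
      exact h4
    simpa using tendsto_finsetSum Finset.univ fun i _ =>
      tendsto_finsetSum Finset.univ fun j _ => h1 i j
  filter_upwards [h.eventually (gt_mem_nhds hε)] with a ha x
  have h1 := abs_quadVal_le (S a - A) x
  rw [sub_eq_add_neg, quadVal_add, quadVal_neg, ← sub_eq_add_neg] at h1
  exact h1.trans (mul_le_mul_of_nonneg_right ha.le (by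
    simpa [dotProduct] using Finset.sum_nonneg fun i _ => mul_self_nonneg (x i)))

namespace PETC

variable {n p kbar : ℕ}

/-- The filter of the PETC systems whose data `A`, `B K`, `Q` are near those of `P`. -/
def nearData (P : PETC n p kbar) : Filter (PETC n p kbar) :=
  comap (fun P' => (P'.A, P'.B * P'.K, P'.Q)) (𝓝 (P.A, P.B * P.K, P.Q))

/-- Matrix entries are bounded by the 2-induced norm, so small balls of that norm fit into any
neighborhood of the three data matrices. -/
theorem exists_isPerturbation_of_eventually (P : PETC n p kbar) {q : PETC n p kbar → Prop}
    (h : ∀ᶠ P' in P.nearData, q P') :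
    ∃ δ : ℝ, 0 < δ ∧ ∀ P', P.IsPerturbation P' δ → q P' := by
  obtain ⟨U, hU, hUq⟩ := mem_comap.mp h
  rw [nhds_prod_eq, nhds_prod_eq, mem_prod_iff] at hU
  obtain ⟨U₁, hU₁, U', hU', hsub⟩ := hU
  obtain ⟨U₂, hU₂, U₃, hU₃, hsub'⟩ := mem_prod_iff.mp hU'
  obtain ⟨δ₁, hδ₁, h₁⟩ := exists_opNorm2_ball_subset _ hU₁
  obtain ⟨δ₂, hδ₂, h₂⟩ := exists_opNorm2_ball_subset _ hU₂
  obtain ⟨δ₃, hδ₃, h₃⟩ := exists_opNorm2_ball_subset _ hU₃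
  refine ⟨min δ₁ (min δ₂ δ₃), by positivity, fun P' ⟨hA, hBK, hQ⟩ => hUq (hsub ⟨?_, hsub' ⟨?_, ?_⟩⟩)⟩
  · exact h₁ _ (hA.trans (min_le_left _ _))
  · exact h₂ _ (hBK.trans ((min_le_right _ _).trans (min_le_left _ _)))
  · exact h₃ _ (hQ.trans ((min_le_right _ _).trans (min_le_right _ _)))

theorem tendsto_M (P : PETC n p kbar) (k : ℕ) :
    Tendsto (fun P' : PETC n p kbar => P'.M k) P.nearData (𝓝 (P.M k)) := by
  have hint : Continuous fun A : Matrix (Fin n) (Fin n) ℝ =>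
      (Matrix.of fun i j => ∫ τ in (0 : ℝ)..(k : ℝ), (NormedSpace.exp (τ • A)) i j) := by
    refine continuous_matrix fun i j => ?_
    refine intervalIntegral.continuous_parametric_intervalIntegral_of_continuous'
      (f := fun (A : Matrix (Fin n) (Fin n) ℝ) τ => (NormedSpace.exp (τ • A)) i j) ?_ _ _
    exact (continuous_matrix_exp.comp (continuous_snd.smul continuous_fst)).matrix_elem i j
  have hA : Tendsto (fun P' : PETC n p kbar => P'.A) P.nearData (𝓝 P.A) :=
    (continuous_fst.tendsto (P.A, P.B * P.K, P.Q)).comp tendsto_comap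
  have hBK : Tendsto (fun P' : PETC n p kbar => P'.B * P'.K) P.nearData (𝓝 (P.B * P.K)) :=
    ((continuous_fst.comp continuous_snd).tendsto (P.A, P.B * P.K, P.Q)).comp tendsto_comap
  have h1 := (continuous_matrix_exp.tendsto ((k : ℝ) • P.A)).comp (hA.const_smul (k : ℝ))
  have h2 := (hint.tendsto P.A).comp hA
  have h3 := h1.add (tendsto_matrix_mul h2 hBK)
  exact h3

theorem tendsto_Q (P : PETC n p kbar) :
    Tendsto (fun P' : PETC n p kbar => P'.Q) P.nearData (𝓝 P.Q) :=
  ((continuous_snd.comp continuous_snd).tendsto (P.A, P.B * P.K, P.Q)).comp tendsto_comap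

theorem tendsto_N (P : PETC n p kbar) (k : ℕ) :
    Tendsto (fun P' : PETC n p kbar => P'.N k) P.nearData (𝓝 (P.N k)) := by
  have hrows : Continuous fun A : Matrix (Fin n) (Fin n) ℝ =>
      (Matrix.fromRows A 1 : Matrix (Fin n ⊕ Fin n) (Fin n) ℝ) := by
    refine continuous_matrix fun i j => ?_
    rcases i with i | i
    · simp only [fromRows_apply_inl]
      fun_prop
    · simp only [fromRows_apply_inr]
      fun_prop
  have h1 := (hrows.tendsto (P.M k)).comp (tendsto_M P k)
  have h2 := tendsto_matrix_mul (tendsto_matrix_mul (tendsto_matrix_transpose h1) (tendsto_Q P)) h1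
  exact h2

theorem tendsto_Mword (P : PETC n p kbar) (σ : List (IST kbar)) :
    Tendsto (fun P' : PETC n p kbar => P'.Mword σ) P.nearData (𝓝 (P.Mword σ)) := by
  induction σ with
  | nil => exact tendsto_const_nhds
  | cons k σ ih => exact tendsto_matrix_mul ih (tendsto_M P k)

/-! ### Inflated cones -/

theorem tendsto_conj_N (P : PETC n p kbar) (σ : List (IST kbar)) (k : ℕ) :
    Tendsto (fun P' : PETC n p kbar => (P'.Mword σ)ᵀ * P'.N k * P'.Mword σ) P.nearData
      (𝓝 ((P.Mword σ)ᵀ * P.N k * P.Mword σ)) :=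
  tendsto_matrix_mul (tendsto_matrix_mul (tendsto_matrix_transpose (tendsto_Mword P σ))
    (tendsto_N P k)) (tendsto_Mword P σ)

/-- The cone of a word in a slightly perturbed system lies in the inflated cone. -/
theorem eventually_coneWord_subset_inflatedConeWord (P : PETC n p kbar) (w : List (IST kbar))
    {ε : ℝ} (hε : 0 < ε) :
    ∀ᶠ P' in P.nearData, P'.coneWord w ⊆ P.inflatedConeWord ε w := by
  have h : ∀ᶠ P' in P.nearData, ∀ i ∈ Finset.range w.length, ∀ j ∈ Finset.range (kbar + 1), ∀ x,
      |quadVal ((P'.Mword (w.take i))ᵀ * P'.N j * P'.Mword (w.take i)) x -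
        quadVal ((P.Mword (w.take i))ᵀ * P.N j * P.Mword (w.take i)) x| ≤ ε * (x ⬝ᵥ x) :=
    (eventually_all_finset _).mpr fun i _ => (eventually_all_finset _).mpr fun j _ =>
      eventually_abs_quadVal_sub_le (tendsto_conj_N P (w.take i) j) hε
  filter_upwards [h] with P' hP' x hx i hi
  have hki := (w[i]).2.2
  have hQ := (mem_coneQ_iff P' w[i] _).mp (hx i hi)
  have hb : ∀ j, j ≤ kbar → _ := fun j hj =>
    abs_le.mp (hP' i (Finset.mem_range.mpr hi) j (Finset.mem_range.mpr (Nat.lt_succ_of_le hj)) x)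
  simp only [← quadVal_conj] at hQ
  refine ⟨fun hk => ?_, fun j h1 h2 => ?_⟩
  · rw [openCone, Set.mem_ofPred_eq, quadVal_add, quadVal_smul_one]
    linarith [hQ.1 hk, (hb _ hki).2]
  · rw [closedCone, Set.mem_ofPred_eq, quadVal_add, quadVal_smul_one, quadVal_neg]
    linarith [hQ.2 j h1 h2, (hb j (by omega)).1]

theorem eventually_simulates_lComplete (P : PETC n p kbar) (l : ℕ) (hl : 1 ≤ l)
    (h : P.NondegeneratePremises l) :
    ∀ᶠ P' in P.nearData, TransitionSystem.Simulates P'.traffic (P.lComplete l hl) := by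
  obtain ⟨ε, hε, -, hinf⟩ := h
  have hall : ∀ᶠ P' in P.nearData, ∀ w ∈ {w : List (IST kbar) | w.length = l},
      P'.coneWord w ⊆ P.inflatedConeWord ε w :=
    (eventually_all_finite (List.finite_length_eq (IST kbar) l)).mpr fun w _ =>
      eventually_coneWord_subset_inflatedConeWord P w hε
  filter_upwards [hall] with P' hP'
  refine simulates_lComplete P P' l hl ?_
  rintro w x ⟨hw, hx⟩
  by_contra hno
  rw [← mem_finBehaviors_iff] at hno
  have hmem := hP' w hw hx
  rw [hinf w hw hno] at hmem
  exact hmem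

/-! ### Strict cones -/

/-- The states from which the word `σ` is produced with all triggering inequalities strict. -/
def strictConeWord (P : PETC n p kbar) : List (IST kbar) → Set (Fin n → ℝ)
  | [] => Set.univ
  | k :: σ => {x | ((k : ℕ) < kbar → 0 < quadVal (P.N k) x) ∧
      (∀ j ∈ Finset.Ico 1 (k : ℕ), quadVal (P.N j) x < 0) ∧ P.M k *ᵥ x ∈ strictConeWord P σ}

/-- Strict cones are stable under perturbations of the system and of the state. -/
theorem eventually_mem_coneWord_of_strict (P : PETC n p kbar) {σ : List (IST kbar)}
    {ι : Type*} {l : Filter ι} {S : ι → PETC n p kbar} (hS : Tendsto S l P.nearData)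
    {y : ι → Fin n → ℝ} {x : Fin n → ℝ} (hy : Tendsto y l (𝓝 x))
    (hx : x ∈ P.strictConeWord σ) : ∀ᶠ a in l, y a ∈ (S a).coneWord σ := by
  induction σ generalizing y x with
  | nil => simp
  | cons k σ ih =>
    obtain ⟨h1, h2, h3⟩ := hx
    have hN : ∀ j, Tendsto (fun a => quadVal ((S a).N j) (y a)) l (𝓝 (quadVal (P.N j) x)) := by
      intro j
      have h4 := continuous_quadVal.tendsto (P.N j, x)
      have h5 := h4.comp (((tendsto_N P j).comp hS).prodMk_nhds hy)
      exact h5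
    have hM : Tendsto (fun a => (S a).M k *ᵥ y a) l (𝓝 (P.M k *ᵥ x)) :=
      tendsto_matrix_mulVec ((tendsto_M P k).comp hS) hy
    have e1 : ∀ᶠ a in l, (k : ℕ) < kbar → 0 < quadVal ((S a).N k) (y a) := by
      by_cases hk : (k : ℕ) < kbar
      · filter_upwards [(hN k).eventually (lt_mem_nhds (h1 hk))] with a ha _ using ha
      · exact Eventually.of_forall fun a h => absurd h hk
    have e2 : ∀ᶠ a in l, ∀ j ∈ Finset.Ico 1 (k : ℕ), quadVal ((S a).N j) (y a) < 0 :=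
      (eventually_all_finset _).mpr fun j hj => (hN j).eventually (gt_mem_nhds (h2 j hj))
    filter_upwards [e1, e2, ih hM h3] with a h1 h2 h3
    rw [mem_coneWord_cons, mem_coneQ_iff]
    exact ⟨⟨h1, fun j hj hj' => (h2 j (Finset.mem_Ico.mpr ⟨hj, hj'⟩)).le⟩, h3⟩

/-- If inflated cones of words that do not occur are empty, then a triggering form vanishing at
a nonzero state of `Q_k` is not negative semidefinite. -/
theorem exists_quadVal_pos (P : PETC n p kbar) {l : ℕ} (hl : 1 ≤ l)
    (h : P.NondegeneratePremises l) {k : IST kbar} {y : Fin n → ℝ} (hy : y ≠ 0)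
    (hyk : y ∈ P.coneQ k) {j : ℕ} (hj : 1 ≤ j) (hjk : j < k) (h0 : quadVal (P.N j) y = 0) :
    ∃ z, 0 < quadVal (P.N j) z := by
  obtain ⟨ε, hε, -, hinf⟩ := h
  by_contra! hneg
  have hjkbar : j < kbar := hjk.trans_le k.2.2
  set j' : IST kbar := ⟨j, hj, hjkbar.le⟩
  have hyy := mul_pos hε (dotProduct_self_pos_of_ne_zero hy)
  -- The word triggers at $j$ instead of $k$ and then follows the true itinerary. It cannot occur if
  -- $N(j)$ is negative semidefinite, yet $y$ violates only its first strict inequality, with value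
  -- exactly $0$, so any inflation contains $y$.
  set w := j' :: P.itinerary (P.M j *ᵥ y) (l - 1) with hw
  have hlen : w.length = l := by
    simp only [hw, List.length_cons, length_itinerary]
    omega
  have hnot : w ∉ P.traffic.finBehaviors l := by
    rw [mem_finBehaviors_iff]
    rintro ⟨x, -, hx⟩
    rw [mem_coneWord_cons, mem_coneQ_iff] at hx
    exact absurd (hx.1.1 hjkbar) (not_lt.mpr (hneg x))
  have hmem : y ∈ P.inflatedConeWord ε w := by
    rw [mem_coneQ_iff] at hyk
    intro i hi
    simp only [openCone, closedCone, Set.mem_ofPred_eq, quadVal_add, quadVal_smul_one, quadVal_neg,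
      quadVal_conj]
    rcases i with _ | i
    · simp only [hw, List.take_zero, Mword, one_mulVec, List.getElem_cons_zero]
      refine ⟨fun _ => ?_, fun i h1 h2 => ?_⟩
      · rw [show ((j' : IST kbar) : ℕ) = j from rfl, h0, zero_add]
        exact hyy
      · linarith [hyk.2 i h1 (h2.trans hjk)]
    · have hrest := mem_coneWord_itinerary P (P.M j *ᵥ y) (l - 1) i
        (by simpa [hw] using hi)
      rw [mem_coneQ_iff] at hrest
      simp only [hw, List.take_succ_cons, Mword, List.getElem_cons_succ, ← mulVec_mulVec]
      refine ⟨fun h1 => ?_, fun i' h1 h2 => ?_⟩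
      · have := hrest.1 h1
        change 0 < quadVal _ (_ *ᵥ (P.M j *ᵥ y)) + _
        linarith
      · have := hrest.2 i' h1 h2
        change 0 ≤ -quadVal _ (_ *ᵥ (P.M j *ᵥ y)) + _
        linarith
  rw [hinf w hlen hnot] at hmem
  exact hmem

/-- An interior point of the cone of a nonsingular word satisfies all inequalities strictly. -/
theorem mem_strictConeWord_of_eventually (P : PETC n p kbar) {l : ℕ} (hl : 1 ≤ l)
    (h : P.NondegeneratePremises l) {σ : List (IST kbar)} (hσ : IsUnit (P.Mword σ).det)
    {x : Fin n → ℝ} (hx0 : x ≠ 0) (hx : ∀ᶠ z in 𝓝 x, z ∈ P.coneWord σ) :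
    x ∈ P.strictConeWord σ := by
  induction σ generalizing x with
  | nil => exact Set.mem_univ _
  | cons k σ ih =>
    rw [Mword, det_mul, IsUnit.mul_iff] at hσ
    have hxk := (mem_coneWord_cons P k σ x).mp hx.self_of_nhds
    have hxQ := (mem_coneQ_iff P k x).mp hxk.1
    -- Invertibility of $M(k)$ makes $M(k)x$ a nonzero interior point of the cone of the remaining
    -- word, as the induction requires.
    have hinv : (P.M k)⁻¹ *ᵥ (P.M k *ᵥ x) = x := by
      rw [mulVec_mulVec, nonsing_inv_mul _ hσ.2, one_mulVec]
    refine ⟨hxQ.1, fun j hj => ?_, ih hσ.1 ?_ ?_⟩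
    · rw [Finset.mem_Ico] at hj
      refine lt_of_le_of_ne (hxQ.2 j hj.1 hj.2) fun h0 => ?_
      obtain ⟨z, hz⟩ := exists_quadVal_pos P hl h hx0 hxk.1 hj.1 hj.2 h0
      refine absurd (quadVal_nonpos_of_eventually h0 ?_ z) (not_le.mpr hz)
      filter_upwards [hx] with z hz
      exact ((mem_coneQ_iff P k z).mp ((mem_coneWord_cons P k σ z).mp hz).1).2 j hj.1 hj.2
    · intro hM
      rw [hM, mulVec_zero] at hinv
      exact hx0 hinv.symm
    · have hc : Continuous fun z : Fin n → ℝ => (P.M k)⁻¹ *ᵥ z :=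
        continuous_const.matrix_mulVec continuous_id
      have ht := hc.tendsto (P.M k *ᵥ x)
      rw [hinv] at ht
      filter_upwards [ht.eventually hx] with z hz
      have := ((mem_coneWord_cons P k σ _).mp hz).2
      rwa [mulVec_mulVec, mul_nonsing_inv _ hσ.2, one_mulVec] at this

end PETC

/-! ## Persistence of simple eigenvalues and their eigenvectors -/

section Eigen

open Polynomial

variable {n : ℕ}

theorem continuous_scalar {𝕜 : Type*} [RCLike 𝕜] :
    Continuous fun z : 𝕜 => scalar (Fin n) z :=
  Continuous.matrix_diagonal (continuous_pi fun _ => continuous_id)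

theorem scalar_sub_mulVec {𝕜 : Type*} [RCLike 𝕜] (z : 𝕜) (T : Matrix (Fin n) (Fin n) 𝕜)
    (w : Fin n → 𝕜) : (scalar (Fin n) z - T) *ᵥ w = z • w - T *ᵥ w := by
  rw [sub_mulVec, scalar_apply, ← smul_one_eq_diagonal, smul_mulVec, one_mulVec]

/-- For a simple eigenvalue `μ`, `adj (μ - T)` maps an eigenvector to a nonzero multiple of it. -/
theorem adjugate_mulVec_eigenvector {𝕜 : Type*} [RCLike 𝕜] {T : Matrix (Fin n) (Fin n) 𝕜}
    {w : Fin n → 𝕜} {μ : 𝕜} (h : T *ᵥ w = μ • w) {q : 𝕜[X]} (hq : T.charpoly = (X - C μ) * q) :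
    (scalar (Fin n) μ - T).adjugate *ᵥ w = q.eval μ • w := by
  have hc1 : Continuous fun z : 𝕜 => (scalar (Fin n) z - T).adjugate *ᵥ w := by
    exact (continuous_scalar.sub continuous_const).matrix_adjugate.matrix_mulVec continuous_const
  have hc2 : Continuous fun z : 𝕜 => q.eval z • w := q.continuous.smul continuous_const
  -- For $z\ne\mu$, applying the adjugate to $(z-T)w=(z-\mu)w$ gives $(z-\mu)q(z)w$; cancel $z-\mu$
  -- and extend to $\mu$ by continuity.
  refine congrFun (Continuous.ext_on (dense_compl_singleton μ) hc1 hc2 fun z hz => ?_) μ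
  have hz' : z - μ ≠ 0 := sub_ne_zero.mpr hz
  have h1 : (scalar (Fin n) z - T) *ᵥ w = (z - μ) • w := by
    rw [scalar_sub_mulVec, h, sub_smul]
  have h2 : (scalar (Fin n) z - T).adjugate *ᵥ ((scalar (Fin n) z - T) *ᵥ w)
      = ((z - μ) * q.eval z) • w := by
    rw [mulVec_mulVec, adjugate_mul, ← eval_charpoly, hq, smul_mulVec, one_mulVec]
    simp
  rw [h1, mulVec_smul, mul_smul] at h2
  exact smul_right_injective _ hz' h2

/-- Since $(z-T)\,\mathrm{adj}(z-T)=\chi_T(z)I$, the adjugate at an eigenvalue produces eigenvectors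
(or zero), continuously in $T$ and $z$. -/
theorem mulVec_adjugate_of_isRoot {𝕜 : Type*} [RCLike 𝕜] {T : Matrix (Fin n) (Fin n) 𝕜} {z : 𝕜}
    (hz : T.charpoly.eval z = 0) (w : Fin n → 𝕜) :
    T *ᵥ ((scalar (Fin n) z - T).adjugate *ᵥ w) = z • ((scalar (Fin n) z - T).adjugate *ᵥ w) := by
  have h : (scalar (Fin n) z - T) *ᵥ ((scalar (Fin n) z - T).adjugate *ᵥ w) = 0 := by
    rw [mulVec_mulVec, mul_adjugate, ← eval_charpoly, hz, zero_smul, zero_mulVec]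
  rw [scalar_sub_mulVec, sub_eq_zero] at h
  exact h.symm

theorem eval_cofactor_ne_zero {p q : ℂ[X]} (hp : p ≠ 0) (hn : p.roots.Nodup) {μ : ℂ}
    (hq : p = (X - C μ) * q) : q.eval μ ≠ 0 := by
  intro h
  subst hq
  rw [roots_mul hp, roots_X_sub_C, Multiset.singleton_add, Multiset.nodup_cons] at hn
  exact hn.1 ((mem_roots (right_ne_zero_of_mul hp)).mpr h)

theorem tendsto_eval_charpoly {𝕜 ι : Type*} [RCLike 𝕜] {l : Filter ι}
    {T : Matrix (Fin n) (Fin n) 𝕜} {S : ι → Matrix (Fin n) (Fin n) 𝕜} (hS : Tendsto S l (𝓝 T))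
    (z : 𝕜) : Tendsto (fun a => (S a).charpoly.eval z) l (𝓝 (T.charpoly.eval z)) := by
  simp only [eval_charpoly]
  have : Continuous fun A : Matrix (Fin n) (Fin n) 𝕜 => (scalar (Fin n) z - A).det :=
    (continuous_const.sub continuous_id).matrix_det
  exact (this.tendsto T).comp hS

/-- Matrix and eigenvalue vary independently, so that the perturbed eigenvalue may be picked
afterwards. -/
theorem tendsto_adjugate_mulVec {𝕜 ι : Type*} [RCLike 𝕜] {l : Filter ι}
    {T : Matrix (Fin n) (Fin n) 𝕜} {S : ι → Matrix (Fin n) (Fin n) 𝕜} (hS : Tendsto S l (𝓝 T))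
    (μ : 𝕜) (w : Fin n → 𝕜) :
    Tendsto (fun a : ι × 𝕜 => (scalar (Fin n) a.2 - S a.1).adjugate *ᵥ w) (l ×ˢ 𝓝 μ)
      (𝓝 ((scalar (Fin n) μ - T).adjugate *ᵥ w)) := by
  have h1 : Tendsto (fun a : ι × 𝕜 => scalar (Fin n) a.2 - S a.1) (l ×ˢ 𝓝 μ)
      (𝓝 (scalar (Fin n) μ - T)) :=
    ((continuous_scalar.tendsto μ).comp tendsto_snd).sub (hS.comp tendsto_fst)
  have hc : Continuous fun A : Matrix (Fin n) (Fin n) 𝕜 => A.adjugate :=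
    continuous_id.matrix_adjugate
  have h2 := hc.tendsto (scalar (Fin n) μ - T)
  have h3 := h2.comp h1
  exact tendsto_matrix_mulVec h3 tendsto_const_nhds

theorem pow_card_le_norm_prod_sub {μ : ℂ} {η : ℝ} (hη : 0 ≤ η) (s : Multiset ℂ)
    (hs : ∀ z ∈ s, η ≤ ‖μ - z‖) : η ^ s.card ≤ ‖(s.map fun z => μ - z).prod‖ := by
  induction s using Multiset.induction with
  | empty => simp
  | cons z s ih =>
    rw [Multiset.card_cons, Multiset.map_cons, Multiset.prod_cons, norm_mul, pow_succ']
    exact mul_le_mul (hs z (Multiset.mem_cons_self z s))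
      (ih fun y hy => hs y (Multiset.mem_cons_of_mem hy)) (by positivity) (norm_nonneg _)

/-- Complex eigenvalues persist under small perturbations. -/
theorem eventually_exists_root_complex {ι : Type*} {l : Filter ι}
    {T : Matrix (Fin n) (Fin n) ℂ} {S : ι → Matrix (Fin n) (Fin n) ℂ} (hS : Tendsto S l (𝓝 T))
    {μ : ℂ} (hμ : T.charpoly.eval μ = 0) {U : Set ℂ} (hU : U ∈ 𝓝 μ) :
    ∀ᶠ a in l, ∃ z ∈ U, (S a).charpoly.eval z = 0 := by
  obtain ⟨η, hη, hball⟩ := Metric.mem_nhds_iff.mp hU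
  have h1 := (tendsto_eval_charpoly hS μ).norm
  rw [hμ, norm_zero] at h1
  -- With all $n$ roots at distance at least $\eta$ from $\mu$, the monic characteristic polynomial
  -- would have modulus at least $\eta^n$ at $\mu$.
  filter_upwards [h1.eventually (gt_mem_nhds (pow_pos hη n))] with a ha
  by_contra! hno
  have hs := IsAlgClosed.splits (S a).charpoly
  have hmon := charpoly_monic (S a)
  have hcard : (S a).charpoly.roots.card = n := by
    rw [← hs.natDegree_eq_card_roots, charpoly_natDegree_eq_dim, Fintype.card_fin]
  refine absurd ha (not_lt.mpr ?_)
  rw [hs.eval_eq_prod_roots, hmon.leadingCoeff, one_mul]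
  conv_lhs => rw [← hcard]
  refine pow_card_le_norm_prod_sub hη.le _ fun z hz => ?_
  by_contra! hlt
  refine hno z (hball ?_) (Polynomial.isRoot_of_mem_roots hz)
  rwa [Metric.mem_ball, dist_comm, dist_eq_norm]

/-- A simple real eigenvalue persists as a real eigenvalue under small perturbations. -/
theorem eventually_exists_root_real {ι : Type*} {l : Filter ι}
    {T : Matrix (Fin n) (Fin n) ℝ} {S : ι → Matrix (Fin n) (Fin n) ℝ} (hS : Tendsto S l (𝓝 T))
    {μ : ℝ} {q : ℝ[X]} (hq : T.charpoly = (X - C μ) * q) (hqμ : q.eval μ ≠ 0) {U : Set ℝ}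
    (hU : U ∈ 𝓝 μ) : ∀ᶠ a in l, ∃ z ∈ U, (S a).charpoly.eval z = 0 := by
  -- Near $\mu$ the cofactor keeps its sign, so $\chi_T$ changes sign at $\mu$; the perturbed
  -- polynomial has the same signs at $\mu\pm\eta/2$, and the intermediate value theorem applies.
  -- The factor $q(\mu)$ fixes the direction of the change.
  have hpos : ∀ᶠ z in 𝓝 μ, 0 < q.eval z * q.eval μ := by
    have hc : Continuous fun z => q.eval z * q.eval μ := by fun_prop
    exact hc.continuousAt.eventually (lt_mem_nhds (mul_self_pos.mpr hqμ))
  obtain ⟨η, hη, hball⟩ := Metric.mem_nhds_iff.mp (inter_mem hU hpos)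
  have hsub : ∀ z ∈ Set.Icc (μ - η / 2) (μ + η / 2), z ∈ U ∧ 0 < q.eval z * q.eval μ := by
    intro z hz
    apply hball
    rw [Metric.mem_ball, Real.dist_eq, abs_lt]
    constructor <;> linarith [hz.1, hz.2]
  have hlo := (tendsto_eval_charpoly hS (μ - η / 2)).mul_const (q.eval μ)
  have hhi := (tendsto_eval_charpoly hS (μ + η / 2)).mul_const (q.eval μ)
  have hlo' : T.charpoly.eval (μ - η / 2) * q.eval μ < 0 := by
    rw [hq]
    simp only [eval_mul, eval_sub, eval_X, eval_C]
    have := (hsub (μ - η / 2) ⟨le_rfl, by linarith⟩).2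
    nlinarith
  have hhi' : 0 < T.charpoly.eval (μ + η / 2) * q.eval μ := by
    rw [hq]
    simp only [eval_mul, eval_sub, eval_X, eval_C]
    have := (hsub (μ + η / 2) ⟨by linarith, le_rfl⟩).2
    nlinarith
  filter_upwards [hlo.eventually (gt_mem_nhds hlo'), hhi.eventually (lt_mem_nhds hhi')] with a h1 h2
  have hc : ContinuousOn (fun z => (S a).charpoly.eval z * q.eval μ)
      (Set.Icc (μ - η / 2) (μ + η / 2)) := by fun_prop
  obtain ⟨z, hz, hz0⟩ := intermediate_value_Icc (by linarith) hc ⟨h1.le, h2.le⟩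
  exact ⟨z, (hsub z hz).1, (mul_eq_zero.mp hz0).resolve_right hqμ⟩

end Eigen

/-! ## Dominant directions -/

section Dominant

open Polynomial

/-- The spectral projections of an endomorphism annihilated by a polynomial with simple roots. -/
theorem exists_spectral_projections {E : Type*} [AddCommGroup E] [Module ℂ E]
    (f : Module.End ℂ E) (s : Finset ℂ) (hs : s.Nonempty)
    (hf : aeval f (∏ z ∈ s, (X - C z)) = 0) :
    ∃ π : ℂ → Module.End ℂ E, (∀ v, ∑ z ∈ s, π z v = v) ∧
      (∀ z ∈ s, ∀ v, f (π z v) = z • π z v) ∧ ∀ z v, f (π z v) = π z (f v) := by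
  classical
  -- Lagrange basis polynomials sum to $1$, and $X-z$ times the one at $z$ is a multiple of the
  -- annihilating product.
  refine ⟨fun z => aeval f (Lagrange.basis s id z), fun v => ?_, fun z hz v => ?_, fun z v => ?_⟩
  · rw [← LinearMap.sum_apply, ← map_sum, Lagrange.sum_basis Function.injective_id.injOn hs]
    simp
  · have h1 : (X - C z) * Lagrange.basis s id z =
        C (∏ j ∈ s.erase z, (z - j)⁻¹) * ∏ z ∈ s, (X - C z) := by
      rw [← Finset.mul_prod_erase s _ hz, Lagrange.basis]
      simp only [Lagrange.basisDivisor, id, Finset.prod_mul_distrib, map_prod]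
      ring
    have h2 : aeval f ((X - C z) * Lagrange.basis s id z) v = 0 := by
      rw [h1, map_mul, hf, mul_zero, LinearMap.zero_apply]
    rw [map_mul, Module.End.mul_apply] at h2
    simpa [sub_eq_zero] using h2
  · have h := congrArg (fun q : ℂ[X] => aeval f q v) (mul_comm X (Lagrange.basis s id z))
    simpa using h

variable {n : ℕ}

/-- The complexification of a real vector. -/
def complexify (x : Fin n → ℝ) : Fin n → ℂ := fun i => (x i : ℂ)

theorem complexify_mulVec (T : Matrix (Fin n) (Fin n) ℝ) (x : Fin n → ℝ) :
    T.map (algebraMap ℝ ℂ) *ᵥ complexify x = complexify (T *ᵥ x) := by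
  funext i
  simp [complexify, mulVec, dotProduct]

theorem continuous_complexify : Continuous (complexify (n := n)) := by
  unfold complexify
  fun_prop

theorem complexify_smul (c : ℝ) (x : Fin n → ℝ) :
    complexify (c • x) = (c : ℂ) • complexify x := by
  funext i
  simp [complexify]

theorem complexify_injective : Function.Injective (complexify (n := n)) := by
  intro x y h
  funext i
  exact Complex.ofReal_injective (congrFun h i)

@[simp]
theorem complexify_zero : complexify (0 : Fin n → ℝ) = 0 := by
  funext i
  simp [complexify]

theorem norm_complexify (x : Fin n → ℝ) : ‖complexify x‖ = ‖x‖ := by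
  simp [Pi.norm_def, complexify]

theorem complexEigenvalues_ne_zero {T : Matrix (Fin n) (Fin n) ℝ} (hT : IsUnit T.det) {z : ℂ}
    (hz : z ∈ complexEigenvalues T) : z ≠ 0 := by
  rintro rfl
  have h := Polynomial.isRoot_of_mem_roots hz
  rw [IsRoot, eval_charpoly, map_zero, zero_sub, det_neg, ← RingHom.mapMatrix_apply,
    ← RingHom.map_det] at h
  simp [hT.ne_zero] at h

/-- The forward orbit of a nonzero vector under a nonsingular matrix with simple eigenvalues
accumulates, after rescaling, at a vector `d ≠ 0` in a sum of eigenspaces to eigenvalues of equal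
modulus. -/
theorem exists_dominant_limit {T : Matrix (Fin n) (Fin n) ℝ} (hT : IsUnit T.det)
    (hn : (complexEigenvalues T).Nodup) {x : Fin n → ℝ} (hx : x ≠ 0) :
    ∃ (d : Fin n → ℝ) (e : ℂ → Fin n → ℂ) (s : Finset ℂ) (z₀ : ℂ), z₀ ∈ s ∧ d ≠ 0 ∧
      (∀ z ∈ s, z ∈ complexEigenvalues T ∧ ‖z‖ = ‖z₀‖ ∧ T.map (algebraMap ℝ ℂ) *ᵥ e z = z • e z) ∧
      complexify d = ∑ z ∈ s, e z ∧
      ∀ D : Set (Fin n → ℝ), (∀ (m : ℕ) (c : ℝ), 0 < c → c • ((T ^ m) *ᵥ x) ∈ D) →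
        d ∈ closure D := by
  classical
  set Tc := T.map (algebraMap ℝ ℂ)
  set f : Module.End ℂ (Fin n → ℂ) := toLin' Tc
  have hf_apply : ∀ v, f v = Tc *ᵥ v := fun v => rfl
  set s₀ : Finset ℂ := (complexEigenvalues T).toFinset
  have hprod : ∏ z ∈ s₀, (X - C z) = Tc.charpoly := by
    have h := (IsAlgClosed.splits Tc.charpoly).eq_prod_roots
    rw [(charpoly_monic Tc).leadingCoeff, C_1, one_mul] at h
    rw [h, Finset.prod, Multiset.toFinset_val, hn.dedup]
    rfl
  have hf : aeval f (∏ z ∈ s₀, (X - C z)) = 0 := by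
    rw [hprod, ← charpoly_toLin']
    exact LinearMap.aeval_self_charpoly f
  have hxc : complexify x ≠ 0 := fun h => hx (complexify_injective (h.trans complexify_zero.symm))
  have hs₀ : s₀.Nonempty := by
    by_contra h
    rw [Finset.not_nonempty_iff_eq_empty] at h
    rw [h, Finset.prod_empty, map_one] at hf
    exact hxc (by simpa using LinearMap.congr_fun hf (complexify x))
  obtain ⟨π, hπsum, hπeig, hπcomm⟩ := exists_spectral_projections f s₀ hs₀ hf
  set u : ℂ → Fin n → ℂ := fun z => π z (complexify x)
  have hsupp : (s₀.filter fun z => u z ≠ 0).Nonempty := by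
    by_contra h
    rw [Finset.not_nonempty_iff_eq_empty, Finset.filter_eq_empty_iff] at h
    refine hxc ?_
    rw [← hπsum (complexify x)]
    exact Finset.sum_eq_zero fun z hz => not_not.mp (h hz)
  -- The maximum is only over eigenvalues with a nonzero component of $x$; division by $|z_0|^m$
  -- then keeps the orbit bounded.
  obtain ⟨z₀, hz₀, hmax⟩ := Finset.exists_max_image _ (fun z => ‖z‖) hsupp
  rw [Finset.mem_filter] at hz₀
  have hρ : 0 < ‖z₀‖ := norm_pos_iff.mpr
    (complexEigenvalues_ne_zero hT (Multiset.mem_toFinset.mp hz₀.1))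
  set y : ℕ → Fin n → ℝ := fun m => (‖z₀‖ ^ m)⁻¹ • ((T ^ m) *ᵥ x)
  have hπpow : ∀ z ∈ s₀, ∀ m : ℕ, π z (complexify ((T ^ m) *ᵥ x)) = z ^ m • u z := by
    intro z hz m
    induction m with
    | zero => simp [u]
    | succ m ih =>
      rw [pow_succ', ← mulVec_mulVec, ← complexify_mulVec, ← hf_apply, ← hπcomm, hπeig z hz, ih,
        smul_smul, pow_succ']
  have hπy : ∀ z ∈ s₀, ∀ m : ℕ, π z (complexify (y m)) = (z / ‖z₀‖) ^ m • u z := by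
    intro z hz m
    rw [complexify_smul, map_smul, hπpow z hz, smul_smul]
    congr 1
    push_cast
    rw [div_pow]
    ring
  have hratio : ∀ z ∈ s₀, u z ≠ 0 → ‖z / ‖z₀‖‖ ≤ 1 := by
    intro z hz hu
    rw [norm_div, Complex.norm_real, norm_norm, div_le_one hρ]
    exact hmax z (Finset.mem_filter.mpr ⟨hz, hu⟩)
  have hbdd : ∀ m, y m ∈ Metric.closedBall (0 : Fin n → ℝ) (∑ z ∈ s₀, ‖u z‖) := by
    intro m
    rw [mem_closedBall_zero_iff, ← norm_complexify, ← hπsum (complexify (y m))]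
    refine (norm_sum_le _ _).trans (Finset.sum_le_sum fun z hz => ?_)
    rw [hπy z hz]
    by_cases hu : u z = 0
    · simp [hu]
    · rw [norm_smul, norm_pow]
      exact mul_le_of_le_one_left (norm_nonneg _) (pow_le_one₀ (norm_nonneg _) (hratio z hz hu))
  obtain ⟨d, -, φ, hφ, hd⟩ := tendsto_subseq_of_bounded Metric.isBounded_closedBall hbdd
  have hlim : ∀ z ∈ s₀, Tendsto (fun k => (z / ‖z₀‖) ^ φ k • u z) atTop
      (𝓝 (π z (complexify d))) := by
    intro z hz
    have hc : Continuous fun v => π z (complexify v) :=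
      (LinearMap.continuous_of_finiteDimensional (π z)).comp continuous_complexify
    refine ((hc.tendsto d).comp hd).congr fun k => ?_
    exact hπy z hz (φ k)
  refine ⟨d, fun z => π z (complexify d), s₀.filter fun z => ‖z‖ = ‖z₀‖, z₀,
    Finset.mem_filter.mpr ⟨hz₀.1, rfl⟩, ?_, ?_, ?_, ?_⟩
  -- The rescaled $z_0$-component has constant nonzero norm, so the limit cannot vanish.
  · rintro rfl
    have h := (hlim z₀ hz₀.1).norm
    simp only [complexify_zero, map_zero, norm_zero, norm_smul, norm_pow, norm_div,
      Complex.norm_real, norm_norm, div_self hρ.ne', one_pow, one_mul] at h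
    exact hz₀.2 (norm_eq_zero.mp (tendsto_nhds_unique tendsto_const_nhds h))
  · intro z hz
    rw [Finset.mem_filter] at hz
    exact ⟨Multiset.mem_toFinset.mp hz.1, hz.2, hπeig z hz.1 _⟩
  -- Components of smaller modulus die out in the limit; those of larger modulus were absent from
  -- $x$.
  · rw [Finset.sum_filter_of_ne, hπsum]
    intro z hz hne
    by_contra hnorm
    refine hne (tendsto_nhds_unique (hlim z hz) ?_)
    by_cases hu : u z = 0
    · simp [hu]
    · have hlt : ‖z / ‖z₀‖‖ < 1 := by
        refine lt_of_le_of_ne (hratio z hz hu) fun h => hnorm ?_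
        rwa [norm_div, Complex.norm_real, norm_norm, div_eq_one_iff_eq hρ.ne'] at h
      simpa using ((tendsto_pow_atTop_nhds_zero_of_norm_lt_one hlt).comp
        hφ.tendsto_atTop).smul_const (u z)
  · intro D hD
    exact mem_closure_of_tendsto hd (Eventually.of_forall fun k => hD _ _ (by positivity))

/-- The forward orbit of a nonzero vector under a nonsingular mixed matrix accumulates, after
rescaling, at a nonzero vector of a basic invariant subspace. -/
theorem exists_dominant_basicInvariant {T : Matrix (Fin n) (Fin n) ℝ} (hT : IsUnit T.det)
    (hm : IsMixed T) {x : Fin n → ℝ} (hx : x ≠ 0) :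
    ∃ d : Fin n → ℝ, d ≠ 0 ∧
      (∀ D : Set (Fin n → ℝ), (∀ (m : ℕ) (c : ℝ), 0 < c → c • ((T ^ m) *ᵥ x) ∈ D) →
        d ∈ closure D) ∧
      ((∃ μ : ℝ, (μ : ℂ) ∈ complexEigenvalues T ∧ T *ᵥ d = μ • d) ∨
        ∃ (μ : ℂ) (w : Fin n → ℂ), μ ∈ complexEigenvalues T ∧ μ.im ≠ 0 ∧ w ≠ 0 ∧
          T.map (algebraMap ℝ ℂ) *ᵥ w = μ • w ∧ (fun i => (w i).im) = μ.im • d) := by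
  obtain ⟨d, e, s, z₀, hz₀, hd, hs, hsum, hD⟩ := exists_dominant_limit hT hm.1 hx
  have hpair : ∀ z ∈ s, z = z₀ ∨ z = starRingEnd ℂ z₀ := by
    intro z hz
    by_cases h : z = z₀
    · exact Or.inl h
    · exact Or.inr (hm.2 z (hs z hz).1 z₀ (hs z₀ hz₀).1 h (hs z hz).2.1)
  have hTd : complexify (T *ᵥ d) = ∑ z ∈ s, z • e z := by
    rw [← complexify_mulVec, hsum, mulVec_sum]
    exact Finset.sum_congr rfl fun z hz => (hs z hz).2.2
  refine ⟨d, hd, hD, ?_⟩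
  by_cases him : z₀.im = 0
  · have hre : ((z₀.re : ℝ) : ℂ) = z₀ := Complex.ext (by simp) (by simp [him])
    refine Or.inl ⟨z₀.re, hre ▸ (hs z₀ hz₀).1, complexify_injective ?_⟩
    rw [hTd, complexify_smul, hre, hsum, Finset.smul_sum]
    refine Finset.sum_congr rfl fun z hz => ?_
    rcases hpair z hz with rfl | rfl
    · rfl
    · rw [Complex.conj_eq_iff_im.mpr him]
  -- The vector $(T-\bar z_0)d$ loses its $\bar z_0$-component, and its imaginary part is a multiple
  -- of $d$ because $T$ and $d$ are real.
  · have hw_im : (fun i => ((complexify (T *ᵥ d) - starRingEnd ℂ z₀ • complexify d) i).im) =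
        z₀.im • d := by
      funext i
      simp [complexify]
    refine Or.inr ⟨z₀, complexify (T *ᵥ d) - starRingEnd ℂ z₀ • complexify d, (hs z₀ hz₀).1, him,
      ?_, ?_, hw_im⟩
    · intro h
      rw [h] at hw_im
      have h0 : z₀.im • d = 0 := by
        rw [← hw_im]
        rfl
      exact (smul_ne_zero him hd) h0
    · rw [hTd, hsum, Finset.smul_sum, ← Finset.sum_sub_distrib, mulVec_sum, Finset.smul_sum]
      refine Finset.sum_congr rfl fun z hz => ?_
      rw [mulVec_sub, mulVec_smul, mulVec_smul, (hs z hz).2.2]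
      rcases hpair z hz with rfl | rfl
      · rw [smul_sub, smul_comm z (starRingEnd ℂ z)]
      · simp

end Dominant

/-! ## Invariant planes -/

section Planes

variable {n : ℕ}

/-- The real part of `z w`. -/
def reMul (z : ℂ) (w : Fin n → ℂ) : Fin n → ℝ := fun i => (z * w i).re

theorem continuous_reMul : Continuous fun q : ℂ × (Fin n → ℂ) => reMul q.1 q.2 := by
  unfold reMul
  fun_prop

/-- In the complex coordinate $z$ of the invariant plane, the real matrix acts as multiplication by
$\mu$. -/
theorem mulVec_reMul {T : Matrix (Fin n) (Fin n) ℝ} {w : Fin n → ℂ} {μ : ℂ}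
    (h : T.map (algebraMap ℝ ℂ) *ᵥ w = μ • w) (z : ℂ) :
    T *ᵥ reMul z w = reMul (z * μ) w := by
  funext i
  have h1 := congrArg (fun c => (z * c).re) (congrFun h i)
  simp only [mulVec, dotProduct, map_apply, Pi.smul_apply, smul_eq_mul, Finset.mul_sum,
    Complex.re_sum] at h1
  rw [reMul, mul_assoc, ← h1]
  change ∑ j, T i j * (z * w j).re = _
  refine Finset.sum_congr rfl fun j _ => ?_
  rw [mul_left_comm]
  exact (Complex.re_ofReal_mul _ _).symm

theorem pow_mulVec_reMul {T : Matrix (Fin n) (Fin n) ℝ} {w : Fin n → ℂ} {μ : ℂ}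
    (h : T.map (algebraMap ℝ ℂ) *ᵥ w = μ • w) (m : ℕ) :
    (T ^ m) *ᵥ reMul 1 w = reMul (μ ^ m) w := by
  induction m with
  | zero => simp
  | succ m ih => rw [pow_succ', ← mulVec_mulVec, ih, mulVec_reMul h, pow_succ]

theorem reMul_ofReal_mul (c : ℝ) (z : ℂ) (w : Fin n → ℂ) : reMul (c * z) w = c • reMul z w := by
  funext i
  simp only [reMul, mul_assoc, Pi.smul_apply, smul_eq_mul]
  exact Complex.re_ofReal_mul _ _

theorem reMul_ne_zero {T : Matrix (Fin n) (Fin n) ℝ} {w : Fin n → ℂ} {μ : ℂ} (hμ : μ.im ≠ 0)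
    (hw : w ≠ 0) (h : T.map (algebraMap ℝ ℂ) *ᵥ w = μ • w) {z : ℂ} (hz : z ≠ 0) :
    reMul z w ≠ 0 := by
  intro h0
  have h1 := mulVec_reMul h z
  rw [h0, mulVec_zero] at h1
  refine hw (funext fun i => ?_)
  have hre : (z * w i).re = 0 := congrFun h0 i
  have him : (z * μ * w i).re = 0 := (congrFun h1 i).symm
  rw [mul_right_comm, Complex.mul_re, hre, zero_mul, zero_sub, neg_eq_zero] at him
  have : z * w i = 0 := Complex.ext hre ((mul_eq_zero.mp him).resolve_right hμ)
  exact (mul_eq_zero.mp this).resolve_left hz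

theorem reMul_mem_span (z : ℂ) (w : Fin n → ℂ) :
    reMul z w ∈ Submodule.span ℝ {(fun i => (w i).re), (fun i => (w i).im)} := by
  refine Submodule.mem_span_pair.mpr ⟨z.re, -z.im, ?_⟩
  funext i
  simp [reMul, Complex.mul_re, sub_eq_add_neg]

/-- A nonzero vector has normalized distance $0$ from itself. -/
theorem notMem_of_le_normDistSets {A F : Set (Fin n → ℝ)} {ε : ℝ} (hε : 0 < ε)
    (h : (ε : EReal) ≤ normDistSets A F) {d : Fin n → ℝ} (hd : d ∈ A) (hd0 : d ≠ 0) : d ∉ F := by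
  intro hF
  have hsq : d ⬝ᵥ d = euclNorm d * euclNorm d := by
    rw [euclNorm, ← sq, EuclideanSpace.real_norm_sq_eq]
    simp [dotProduct, sq]
  have h1 : normDistSets A F ≤ ((1 - (d ⬝ᵥ d) / (euclNorm d * euclNorm d) : ℝ) : EReal) := by
    refine iInf_le_of_le d (iInf_le_of_le hd (iInf_le_of_le hd0 ?_))
    exact iInf_le_of_le d (iInf_le_of_le hF (iInf_le_of_le hd0 le_rfl))
  rw [← hsq, div_self (dotProduct_self_pos_of_ne_zero hd0).ne', sub_self] at h1
  exact absurd (EReal.coe_le_coe_iff.mp (h.trans h1)) (not_le.mpr hε)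

theorem IsPreconnected.subset_interior_of_disjoint_frontier {X : Type*} [TopologicalSpace X]
    {s C : Set X} (hs : IsPreconnected s) (hf : Disjoint s (frontier C))
    (hne : (s ∩ interior C).Nonempty) : s ⊆ interior C := by
  refine hs.subset_left_of_subset_union isOpen_interior (isClosed_closure (s := C)).isOpen_compl
    ?_ ?_ hne
  · exact disjoint_compl_right.mono_left interior_subset_closure
  · intro x hx
    by_cases hc : x ∈ closure C
    · by_contra hno
      rw [Set.mem_union, not_or] at hno
      exact Set.disjoint_left.mp hf hx ⟨hc, hno.1⟩
    · exact Or.inr hc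

theorem isPreconnected_image_reMul (w : Fin n → ℂ) :
    IsPreconnected ((fun z => reMul z w) '' {0}ᶜ) := by
  refine IsPreconnected.image ?_ _ ?_
  · refine (isConnected_compl_singleton_of_one_lt_rank ?_ 0).isPreconnected
    rw [Complex.rank_real_complex]
    exact Cardinal.one_lt_two
  · have hc : Continuous fun z : ℂ => reMul z w := by
      unfold reMul
      fun_prop
    exact hc.continuousOn

/-- The tube lemma with a filter in the first factor. -/
theorem IsCompact.eventually_forall_of_eventually_prod {α β : Type*} [TopologicalSpace β]
    {K : Set β} (hK : IsCompact K) {l : Filter α} {q : α → β → Prop}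
    (h : ∀ y ∈ K, ∀ᶠ a in l ×ˢ 𝓝 y, q a.1 a.2) : ∀ᶠ a in l, ∀ y ∈ K, q a y := by
  refine hK.induction_on (p := fun s => ∀ᶠ a in l, ∀ y ∈ s, q a y) (by simp) ?_ ?_ ?_
  · intro s t hst ht
    filter_upwards [ht] with a ha y hy using ha y (hst hy)
  · intro s t hs ht
    filter_upwards [hs, ht] with a h1 h2 y hy using hy.elim (h1 y) (h2 y)
  · intro y hy
    obtain ⟨pa, hpa, pb, hpb, hq⟩ := eventually_prod_iff.mp (h y hy)
    refine ⟨{z | pb z}, mem_nhdsWithin_of_mem_nhds hpb, ?_⟩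
    filter_upwards [hpa] with a ha z hz using hq ha hz

end Planes

/-! ## Persistence of periodic words -/

namespace PETC

open Polynomial

variable {n p kbar : ℕ}

/-- A perturbed eigenvector near $d$ stays in the strict cone's neighborhood, and its orbit only
rescales it. The eigenvalue remains real because it is simple. -/
theorem eventually_orbit_of_real_eigenvector (P : PETC n p kbar) {σ : List (IST kbar)}
    (hT : IsUnit (P.Mword σ).det) (hn : (complexEigenvalues (P.Mword σ)).Nodup)
    {μ : ℝ} (hμ : (μ : ℂ) ∈ complexEigenvalues (P.Mword σ)) {d : Fin n → ℝ}
    (hd : P.Mword σ *ᵥ d = μ • d) (hstrict : d ∈ P.strictConeWord σ) :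
    ∀ᶠ P' in P.nearData, ∃ x, ∀ m : ℕ, (P'.Mword σ ^ m) *ᵥ x ∈ P'.coneWord σ := by
  have hμ0 : μ ≠ 0 := fun h => complexEigenvalues_ne_zero hT hμ (by simp [h])
  have hroot : (P.Mword σ).charpoly.IsRoot μ := by
    have h := isRoot_of_mem_roots hμ
    rw [charpoly_map] at h
    exact h.of_map (f := algebraMap ℝ ℂ) (algebraMap ℝ ℂ).injective
  obtain ⟨q, hq⟩ := dvd_iff_isRoot.mpr hroot
  have hqμ : q.eval μ ≠ 0 := by
    intro h0
    have hqC : ((P.Mword σ).map (algebraMap ℝ ℂ)).charpoly =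
        (X - C (μ : ℂ)) * q.map (algebraMap ℝ ℂ) := by
      rw [charpoly_map, hq, Polynomial.map_mul, Polynomial.map_sub, map_X, map_C]
      rfl
    refine eval_cofactor_ne_zero (charpoly_monic _).ne_zero hn hqC ?_
    have h1 := eval_map_apply (algebraMap ℝ ℂ) (p := q) μ
    rw [h0, map_zero] at h1
    exact h1
  have hlim := (tendsto_adjugate_mulVec (tendsto_Mword P σ) μ d).const_smul (q.eval μ)⁻¹
  rw [adjugate_mulVec_eigenvector hd hq, inv_smul_smul₀ hqμ] at hlim
  have hmem := P.eventually_mem_coneWord_of_strict (tendsto_fst (g := 𝓝 μ)) hlim hstrict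
  have hne : ∀ᶠ a : PETC n p kbar × ℝ in P.nearData ×ˢ 𝓝 μ, a.2 ≠ 0 :=
    tendsto_snd.eventually (eventually_ne_nhds hμ0)
  -- This fixes how close the eigenvalue must be before a root that close is chosen.
  obtain ⟨pa, hpa, pb, hpb, hab⟩ := eventually_prod_iff.mp (hmem.and hne)
  filter_upwards [hpa, eventually_exists_root_real (tendsto_Mword P σ) hq hqμ hpb]
    with P' hP' ⟨z, hz, hz0⟩
  obtain ⟨h1, h2⟩ := hab hP' hz
  refine ⟨(q.eval μ)⁻¹ • ((scalar (Fin n) z - P'.Mword σ).adjugate *ᵥ d), fun m => ?_⟩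
  have heig : ∀ m : ℕ, (P'.Mword σ ^ m) *ᵥ
      ((q.eval μ)⁻¹ • ((scalar (Fin n) z - P'.Mword σ).adjugate *ᵥ d)) =
      z ^ m • ((q.eval μ)⁻¹ • ((scalar (Fin n) z - P'.Mword σ).adjugate *ᵥ d)) := by
    intro m
    induction m with
    | zero => simp
    | succ m ih =>
      rw [pow_succ', ← mulVec_mulVec, ih, mulVec_smul, mulVec_smul,
        mulVec_adjugate_of_isRoot hz0, smul_comm _ z, smul_smul, pow_succ]
  rw [heig]
  exact P'.smul_mem_coneWord h1 (pow_ne_zero m h2)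

/-- The perturbed orbit may turn in any direction of its plane, so the cone must contain all of
them; compactness of the unit circle makes the openness uniform, and scaling does the rest. -/
theorem eventually_orbit_of_complex_eigenvector (P : PETC n p kbar) {σ : List (IST kbar)}
    (hn : (complexEigenvalues (P.Mword σ)).Nodup)
    {μ : ℂ} (hμ : μ ∈ complexEigenvalues (P.Mword σ)) (hμ0 : μ ≠ 0) {w : Fin n → ℂ}
    (hw : (P.Mword σ).map (algebraMap ℝ ℂ) *ᵥ w = μ • w)
    (hstrict : ∀ z : ℂ, z ≠ 0 → reMul z w ∈ P.strictConeWord σ) :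
    ∀ᶠ P' in P.nearData, ∃ x, ∀ m : ℕ, (P'.Mword σ ^ m) *ᵥ x ∈ P'.coneWord σ := by
  obtain ⟨q, hq⟩ := dvd_iff_isRoot.mpr (isRoot_of_mem_roots hμ)
  have hqμ := eval_cofactor_ne_zero (charpoly_monic _).ne_zero hn hq
  have hS : Tendsto (fun P' : PETC n p kbar => (P'.Mword σ).map (algebraMap ℝ ℂ)) P.nearData
      (𝓝 ((P.Mword σ).map (algebraMap ℝ ℂ))) := by
    have hc : Continuous fun A : Matrix (Fin n) (Fin n) ℝ => A.map (algebraMap ℝ ℂ) :=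
      continuous_id.matrix_map Complex.continuous_ofReal
    have h1 := (hc.tendsto (P.Mword σ)).comp (tendsto_Mword P σ)
    exact h1
  have hlim := (tendsto_adjugate_mulVec hS μ w).const_smul (q.eval μ)⁻¹
  rw [adjugate_mulVec_eigenvector hw hq, inv_smul_smul₀ hqμ] at hlim
  set w' : PETC n p kbar × ℂ → Fin n → ℂ := fun a => (q.eval μ)⁻¹ •
    ((scalar (Fin n) a.2 - (a.1.Mword σ).map (algebraMap ℝ ℂ)).adjugate *ᵥ w)
  have hmem : ∀ᶠ a in P.nearData ×ˢ 𝓝 μ, ∀ u ∈ Metric.sphere (0 : ℂ) 1,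
      reMul u (w' a) ∈ a.1.coneWord σ := by
    refine (isCompact_sphere (0 : ℂ) 1).eventually_forall_of_eventually_prod fun u hu => ?_
    have hu0 : u ≠ 0 := by
      rintro rfl
      simp at hu
    have h1 := continuous_reMul.tendsto (u, w)
    have h2 := h1.comp ((tendsto_snd (f := P.nearData ×ˢ 𝓝 μ) (g := 𝓝 u)).prodMk_nhds
      (hlim.comp tendsto_fst))
    exact P.eventually_mem_coneWord_of_strict (tendsto_fst.comp tendsto_fst) h2 (hstrict u hu0)
  have hne : ∀ᶠ a : PETC n p kbar × ℂ in P.nearData ×ˢ 𝓝 μ, a.2 ≠ 0 :=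
    tendsto_snd.eventually (eventually_ne_nhds hμ0)
  obtain ⟨pa, hpa, pb, hpb, hab⟩ := eventually_prod_iff.mp (hmem.and hne)
  filter_upwards [hpa, eventually_exists_root_complex hS (isRoot_of_mem_roots hμ) hpb]
    with P' hP' ⟨z, hz, hz0⟩
  obtain ⟨h1, h2⟩ := hab hP' hz
  have heig : (P'.Mword σ).map (algebraMap ℝ ℂ) *ᵥ w' (P', z) = z • w' (P', z) := by
    simp only [w']
    rw [mulVec_smul, mulVec_adjugate_of_isRoot hz0, smul_comm _ z]
  refine ⟨reMul 1 (w' (P', z)), fun m => ?_⟩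
  have hzm : ‖z ^ m‖ ≠ 0 := norm_ne_zero_iff.mpr (pow_ne_zero m h2)
  have hpolar : z ^ m = (‖z ^ m‖ : ℝ) * (z ^ m / (‖z ^ m‖ : ℝ)) := by
    rw [mul_div_cancel₀]
    exact Complex.ofReal_ne_zero.mpr hzm
  rw [pow_mulVec_reMul heig, hpolar, reMul_ofReal_mul]
  refine P'.smul_mem_coneWord (h1 _ ?_) hzm
  rw [mem_sphere_zero_iff_norm, norm_div, Complex.norm_real, norm_norm, div_self hzm]

/-- Under the nondegeneracy premises, a regular periodic word persists under perturbations. -/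
theorem eventually_eventuallyRepeats (P : PETC n p kbar) {l : ℕ} (hl : 1 ≤ l)
    (h : P.NondegeneratePremises l) {σ : List (IST kbar)} (hrec : P.traffic.EventuallyRepeats σ)
    (hreg : P.IsRegular σ) : ∀ᶠ P' in P.nearData, P'.traffic.EventuallyRepeats σ := by
  have hσ := hrec.1
  obtain ⟨x, hx⟩ := (eventuallyRepeats_iff P hσ).mp hrec
  simp only [eventuallyRepeats_iff _ hσ]
  obtain ⟨⟨hT, hm, -⟩, hfar⟩ := hreg
  have hfar' : ∀ V, IsBasicInvariant (P.Mword σ) V → ∀ y ∈ V, y ≠ 0 →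
      y ∉ frontier (P.coneWord σ) := by
    intro V hV y hy hy0
    obtain ⟨ε, hε, hle⟩ := hfar V hV
    exact notMem_of_le_normDistSets hε hle hy hy0
  have hstrict : ∀ y ≠ 0, y ∈ interior (P.coneWord σ) → y ∈ P.strictConeWord σ :=
    fun y hy hint => P.mem_strictConeWord_of_eventually hl h hT hy (mem_interior_iff_mem_nhds.mp hint)
  -- The origin is fixed and all forms vanish there, so its membership in a cone does not depend on
  -- the system.
  by_cases hx0 : x = 0
  · subst hx0
    refine Eventually.of_forall fun P' => ⟨0, fun m i hi => ?_⟩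
    have h0 := hx m i hi
    rw [mulVec_zero, mulVec_zero, mem_coneQ_iff] at h0 ⊢
    simpa only [quadVal_zero] using h0
  obtain ⟨d, hd0, hD, hcase⟩ := exists_dominant_basicInvariant hT hm hx0
  have hclosure : d ∈ closure (P.coneWord σ) :=
    hD _ fun m c hc => P.smul_mem_coneWord (hx m) hc.ne'
  have hint : d ∉ frontier (P.coneWord σ) → d ∈ interior (P.coneWord σ) := fun hf => by
    by_contra hno
    exact hf ⟨hclosure, hno⟩
  rcases hcase with ⟨μ, hμ, hTd⟩ | ⟨μ, w, hμ, him, hw0, hTw, hwd⟩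
  · refine P.eventually_orbit_of_real_eigenvector hT hm.1 hμ hTd (hstrict d hd0 (hint ?_))
    exact hfar' _ (Or.inl ⟨μ, d, hd0, hTd, rfl⟩) d (Submodule.mem_span_singleton_self d) hd0
  · have hne : ∀ z : ℂ, z ≠ 0 → reMul z w ≠ 0 := fun z hz => reMul_ne_zero him hw0 hTw hz
    have hV : ∀ z : ℂ, z ≠ 0 → reMul z w ∉ frontier (P.coneWord σ) := fun z hz =>
      hfar' _ (Or.inr ⟨μ, w, him, hw0, hTw, rfl⟩) _ (reMul_mem_span z w) (hne z hz)
    -- This coordinate picks out $d$, as $\mathrm{Re}(-iw)=\mathrm{Im}\,w=(\mathrm{Im}\,\mu)d$.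
    have hz₀ : (-Complex.I / μ.im : ℂ) ≠ 0 :=
      div_ne_zero (neg_ne_zero.mpr Complex.I_ne_zero) (Complex.ofReal_ne_zero.mpr him)
    have hdw : reMul (-Complex.I / μ.im) w = d := by
      funext i
      have h1 : (w i).im = μ.im * d i := congrFun hwd i
      have h2 : (-Complex.I / μ.im * w i).re = (w i).im / μ.im := by
        rw [div_mul_eq_mul_div, Complex.div_ofReal_re]
        simp
      rw [reMul, h2, h1, mul_div_cancel_left₀ _ him]
    have hsub := (isPreconnected_image_reMul w).subset_interior_of_disjoint_frontier
      (C := P.coneWord σ) (Set.disjoint_left.mpr (by rintro _ ⟨z, hz, rfl⟩; exact hV z hz))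
      ⟨d, ⟨_, hz₀, hdw⟩, hint (hdw ▸ hV _ hz₀)⟩
    refine P.eventually_orbit_of_complex_eigenvector hm.1 hμ (complexEigenvalues_ne_zero hT hμ) hTw
      fun z hz => hstrict _ (hne z hz) (hsub ⟨z, hz, rfl⟩)

end PETC

end

theorem mainTheorem5 {n p kbar : ℕ} (P : PETC n p kbar) (l : ℕ) (hl : 1 ≤ l)
    (hsace : TransitionSystem.IsSACESimulation istWeight P.traffic (P.lComplete l hl))
    (σ : List (IST kbar))
    (hσ : σ ∈ (P.lComplete l hl).smallestAvgCycles istWeight)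
    (hrec : P.traffic.EventuallyRepeats σ)
    (hreg : P.IsRegular σ)
    (hnondeg : P.NondegeneratePremises l) :
    ∃ δ : ℝ, 0 < δ ∧ ∀ P' : PETC n p kbar, P.IsPerturbation P' δ →
      TransitionSystem.IsSACESimulation istWeight P'.traffic (P.lComplete l hl) := by
  refine P.exists_isPerturbation_of_eventually ?_
  filter_upwards [P.eventually_simulates_lComplete l hl hnondeg,
    P.eventually_eventuallyRepeats hl hnondeg hrec hreg] with P' hsim hrep
  exact ⟨P'.nonBlocking_traffic, hsace.2.1, hsim, σ, hσ, hrep⟩
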